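/- Let $D\subset\mathbb C$ be a nonempty set with $D\pm1=D$ (for instance $D=s_0+\mathbb Z$), and let $T^{\pm}f(s)=f(s\pm1)$ on the space of all functions $f:D\to\mathbb C$. Let $H=A(s)T^{+}+C(s)T^{-}+B(s)$ with $A(s)C(s)\neq0$ for all $s\in D$, and let $X$ be multiplication by a function $x(s)$ (the grid) which is nondegenerate: $x(s)\ne x(s+1)$ and $x(s)\neq x(s+2)$ for all $s\in D$. Put $Y=[H,X]$. Suppose that for some polynomials $W_0,W_1,W_2\in\mathbb C[t]$ $$[H,[H,X]]=W_1(H)X+W_2(H)[H,X]+W_0(H).$$ Then: 1. $\deg W_2\le1$, $\deg W_1\le2$ and $\deg W_0\le 2$. 2. There are $\eta,\zeta\in\mathbb C$ with $x(s+1)+x(s-1)+\eta x(s)+\zeta=0$ for all $s\in D$; that is, $x$ is an Askey–Wilson grid. On every lattice $s_0+\mathbb Z\subset D$ there are constants $c_0,c_1,c_2$ such that, for all $n\in\mathbb Z$, either $x(s_0+n)=c_1q^n+c_2q^{-n}+c_0$ with some $q\ne0,\pm1$, or $x(s_0+n)=c_2n^2+c_1n+c_0$, or $x(s_0+n)=(-1)^n(c_1+c_2n)+c_0$.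 3. On every lattice $s_0+\mathbb Z\subset D$, $H$ is an Askey–Wilson difference operator on the grid $x$, up to an additive constant and a similarity transformation: there are polynomials $\sigma,\tau$ with $\deg\sigma\le2$, $\deg\tau\le1$, a constant $r$ and a nowhere vanishing function $F$ such that $F(s)\,H\,F(s)^{-1}=L+r$, where $$(Lf)(s)=\frac{\sigma(x(s))}{x(s+1)-x(s-1)}\left(\frac{f(s+1)-f(s)}{x(s+1)-x(s)}-\frac{f(s)-f(s-1)}{x(s)-x(s-1)}\right)+\tau(x(s))\left(\frac{f(s+1)-f(s)}{x(s+1)-x(s)}+\frac{f(s)-f(s-1)}{x(s)-x(s-1)}\right).$$ The only possible exceptions are the following confluent operators on a linear or exponential grid: either $x(s_0+n)=c_1n+c_0$ and $g(n)=n$, or $x(s_0+n)=c_1q^n+c_0$ with $q\neq0$ and $g(n)=q^{-n}$; and there are constants $k,l,m$ with $l\ne0$ such that either $B(s_0+n)=k+l\,g(n)$ and $A(s_0+n-1)C(s_0+n)=m$ for all $n\in\mathbb Z$, or $B(s_0+n)=m$ and $A(s_0+n-1)C(s_0+n)=k+l\,g(n)$ for all $n\in\mathbb Z$. 4. $H,X,Y$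 satisfy the relations of the Askey–Wilson algebra $AW(3)$. Precisely, there are constants $\rho,a_1,a_2,c_2,d,g_2\in\mathbb C$ with $W_2(t)=2\rho t+a_2$, $W_1(t)=-2\rho t^2-2a_2t-c_2$, $W_0(t)=-a_1t^2-dt-g_2$, and for every lattice $s_0+\mathbb Z\subset D$ there are constants $c_1,g_1\in\mathbb C$ (so in general $c_1$ and $g_1$ are $1$-periodic functions of $s\in D$) such that $K_1=H$, $K_2=X$, $K_3=Y$, acting on functions on $s_0+\mathbb Z$, satisfy $$[K_1,K_2]=K_3,$$ $$[K_2,K_3]=2\rho K_2K_1K_2+a_1(K_1K_2+K_2K_1)+a_2K_2^2+c_1K_1+dK_2+g_1,$$ $$[K_3,K_1]=2\rho K_1K_2K_1+a_2(K_1K_2+K_2K_1)+a_1K_1^2+c_2K_2+dK_1+g_2.$$ -/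

import Mathlib

open Polynomial

/-- A nonempty set of complex numbers stable under `s ↦ s + 1` and `s ↦ s - 1`:
the set over which the variable `s` ranges. -/
structure ShiftDomain where
  carrier : Set ℂ
  nonempty : carrier.Nonempty
  add_one_mem : ∀ s ∈ carrier, s + 1 ∈ carrier
  sub_one_mem : ∀ s ∈ carrier, s - 1 ∈ carrier

namespace ShiftDomain

/-- The lattice `s₀ + ℤ`. -/
def lattice (s₀ : ℂ) : ShiftDomain where
  carrier := {s | ∃ n : ℤ, s = s₀ + n}
  nonempty := ⟨s₀, 0, by simp⟩
  add_one_mem := by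
    rintro s ⟨n, rfl⟩
    exact ⟨n + 1, by push_cast; ring⟩
  sub_one_mem := by
    rintro s ⟨n, rfl⟩
    exact ⟨n - 1, by push_cast; ring⟩

/-- The space of all complex functions of `s`. -/
abbrev Fun (D : ShiftDomain) : Type := D.carrier → ℂ

/-- The algebra of linear operators on the functions of `s`. -/
abbrev Op (D : ShiftDomain) : Type := Module.End ℂ D.Fun

/-- `(T⁺ f)(s) = f(s + 1)`. -/
def shiftUp (D : ShiftDomain) : D.Op where
  toFun f := fun s => f ⟨(s : ℂ) + 1, D.add_one_mem s s.2⟩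
  map_add' _ _ := rfl
  map_smul' _ _ := rfl

/-- `(T⁻ f)(s) = f(s - 1)`. -/
def shiftDown (D : ShiftDomain) : D.Op where
  toFun f := fun s => f ⟨(s : ℂ) - 1, D.sub_one_mem s s.2⟩
  map_add' _ _ := rfl
  map_smul' _ _ := rfl

/-- Multiplication by `g(s)`. -/
def mulOp (D : ShiftDomain) (g : ℂ → ℂ) : D.Op where
  toFun f := fun s => g s * f s
  map_add' f₁ f₂ := by funext s; simp [mul_add]
  map_smul' c f := by funext s; simp [mul_left_comm]

/-- The second-order difference operator `A(s) T⁺ + C(s) T⁻ + B(s)`. -/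
def diffOp (D : ShiftDomain) (A B C : ℂ → ℂ) : D.Op :=
  D.mulOp A * D.shiftUp + D.mulOp C * D.shiftDown + D.mulOp B

/-- The divided difference `f ↦ (f(s+1) - f(s)) / (x(s+1) - x(s))` on the grid `x`. -/
noncomputable def forwardDiff (D : ShiftDomain) (x : ℂ → ℂ) : D.Op :=
  D.mulOp (fun s => (x (s + 1) - x s)⁻¹) * (D.shiftUp - 1)

/-- The divided difference `f ↦ (f(s) - f(s-1)) / (x(s) - x(s-1))` on the grid `x`. -/
noncomputable def backwardDiff (D : ShiftDomain) (x : ℂ → ℂ) : D.Op :=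
  D.mulOp (fun s => (x s - x (s - 1))⁻¹) * (1 - D.shiftDown)

/-- The Askey-Wilson difference operator on the grid `x` with coefficient polynomials `σ`, `τ`,
that is, the difference operator of hypergeometric type on a nonuniform grid
`σ(x(s)) / (x(s+1) - x(s-1)) * (Δ/Δx - ∇/∇x) + τ(x(s)) * (Δ/Δx + ∇/∇x)`. -/
noncomputable def awOp (D : ShiftDomain) (x : ℂ → ℂ) (σ τ : ℂ[X]) : D.Op :=
  D.mulOp (fun s => σ.eval (x s) / (x (s + 1) - x (s - 1))) *
      (D.forwardDiff x - D.backwardDiff x) +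
    D.mulOp (fun s => τ.eval (x s)) * (D.forwardDiff x + D.backwardDiff x)

/-- Up to an additive constant, and up to a similarity transformation `H ↦ F(s) H F(s)⁻¹` with
a nowhere vanishing function `F`, the operator `H` is an Askey-Wilson difference operator on the
grid `x`, with `deg σ ≤ 2` and `deg τ ≤ 1`. -/
def IsAskeyWilsonOp (D : ShiftDomain) (x : ℂ → ℂ) (H : D.Op) : Prop :=
  ∃ (σ τ : ℂ[X]) (r : ℂ) (F : ℂ → ℂ), σ.natDegree ≤ 2 ∧ τ.natDegree ≤ 1 ∧
    (∀ s ∈ D.carrier, F s ≠ 0) ∧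
    D.mulOp F * H * D.mulOp (fun s => (F s)⁻¹) = D.awOp x σ τ + algebraMap ℂ D.Op r

end ShiftDomain

/-- The explicit Askey-Wilson grids on the lattice `s₀ + ℤ`: the `q`-quadratic ones, the quadratic
ones (`q = 1`), and the ones for `q = -1`. -/
def IsExplicitAWGrid (x : ℂ → ℂ) (s₀ : ℂ) : Prop :=
  ∃ c₀ c₁ c₂ : ℂ,
    (∃ q : ℂ, q ≠ 0 ∧ q ≠ 1 ∧ q ≠ -1 ∧
      ∀ n : ℤ, x (s₀ + n) = c₁ * q ^ n + c₂ * q ^ (-n) + c₀) ∨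
    (∀ n : ℤ, x (s₀ + n) = c₂ * (n : ℂ) ^ 2 + c₁ * n + c₀) ∨
    (∀ n : ℤ, x (s₀ + n) = (-1) ^ n * (c₁ + c₂ * (n : ℂ)) + c₀)

/-- The exceptional confluent operators `A(s) T⁺ + C(s) T⁻ + B(s)` on the lattice `s₀ + ℤ`.
They live on a purely linear grid (then `g n = n`) or a purely exponential grid
(then `g n = q ^ (-n)`), and one of `B(s)`, `A(s-1) C(s)` is constant while the other one is
`k + l * g` with `l ≠ 0`. -/
def IsConfluentOnLattice (A B C x : ℂ → ℂ) (s₀ : ℂ) : Prop :=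
  ∃ g : ℤ → ℂ,
    ((∃ c₀ c₁ : ℂ, ∀ n : ℤ, x (s₀ + n) = c₁ * n + c₀ ∧ g n = n) ∨
      (∃ c₀ c₁ q : ℂ, q ≠ 0 ∧ ∀ n : ℤ, x (s₀ + n) = c₁ * q ^ n + c₀ ∧ g n = q ^ (-n))) ∧
    ∃ k l m : ℂ, l ≠ 0 ∧
      ((∀ n : ℤ, B (s₀ + n) = k + l * g n ∧ A (s₀ + n - 1) * C (s₀ + n) = m) ∨
        (∀ n : ℤ, B (s₀ + n) = m ∧ A (s₀ + n - 1) * C (s₀ + n) = k + l * g n))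

/-- The defining relations of the Askey-Wilson algebra `AW(3)` with the structure constants
`ρ, a₁, a₂, c₁, c₂, d, g₁, g₂`, for three elements `K₁, K₂, K₃` of an associative algebra. -/
structure IsAW3 {𝔄 : Type*} [Ring 𝔄] [Algebra ℂ 𝔄] (ρ a₁ a₂ c₁ c₂ d g₁ g₂ : ℂ)
    (K₁ K₂ K₃ : 𝔄) : Prop where
  comm₁₂ : ⁅K₁, K₂⁆ = K₃
  comm₂₃ : ⁅K₂, K₃⁆ = (2 * ρ) • (K₂ * K₁ * K₂) + a₁ • (K₁ * K₂ + K₂ * K₁) + a₂ • K₂ ^ 2 +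
    c₁ • K₁ + d • K₂ + algebraMap ℂ 𝔄 g₁
  comm₃₁ : ⁅K₃, K₁⁆ = (2 * ρ) • (K₁ * K₂ * K₁) + a₂ • (K₁ * K₂ + K₂ * K₁) + a₁ • K₁ ^ 2 +
    c₂ • K₂ + d • K₁ + algebraMap ℂ 𝔄 g₂

/-! On one lattice `s₀ + ℤ` functions are two-sided sequences and `H` is a three-term operator.
Tested on delta sequences, the relation bounds the degrees: `[H,[H,X]]` moves the support by at most
two places, while excess terms of the `Wᵢ` would move it further. Comparing the coefficients of the
shifts then gives `IsAWData`: equations for `x`, for `B`, and for `u n = A (n-1) * C n`, the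
combination invariant under conjugation by a function.

Multiplied by a difference of grid values, each equation telescopes to a first integral. The first
two integrals amount to the `AW(3)` relation for `[K₂, K₃]`, with their constants as `c₁` and `g₁`;
the relation for `[K₃, K₁]` is the hypothesis rearranged. The second and third integrals express `B`
and `u` through `x`.

`H` is an Askey-Wilson operator once the numerator of `u` splits as in `awFactor_mul_awFactor`,
which asks for `α, β, γ` solving three quadratic equations. `exists_aw_params` reduces these to a
polynomial equation of degree at most four in one unknown. Over `ℂ` it is solvable unless the
polynomial is a nonzero constant, and that exception forces a linear or exponential grid and a
confluent operator. -/

/-! ### Intertwining maps -/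

/-- The linear map `π` intertwines the endomorphisms `S` and `S'`. -/
def Intertwines {E F : Type*} [AddCommGroup E] [Module ℂ E] [AddCommGroup F] [Module ℂ F]
    (π : E →ₗ[ℂ] F) (S : Module.End ℂ E) (S' : Module.End ℂ F) : Prop :=
  ∀ f, π (S f) = S' (π f)

namespace Intertwines

variable {E F : Type*} [AddCommGroup E] [Module ℂ E] [AddCommGroup F] [Module ℂ F]
  {π : E →ₗ[ℂ] F} {S T : Module.End ℂ E} {S' T' : Module.End ℂ F}

theorem add (h : Intertwines π S S') (k : Intertwines π T T') :
    Intertwines π (S + T) (S' + T') := fun f => by simp [h f, k f]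

theorem sub (h : Intertwines π S S') (k : Intertwines π T T') :
    Intertwines π (S - T) (S' - T') := fun f => by simp [h f, k f]

theorem mul (h : Intertwines π S S') (k : Intertwines π T T') :
    Intertwines π (S * T) (S' * T') := fun f => by simp [h (T f), k f]

theorem smul (a : ℂ) (h : Intertwines π S S') : Intertwines π (a • S) (a • S') :=
  fun f => by simp [h f]

theorem scalar (π : E →ₗ[ℂ] F) (a : ℂ) :
    Intertwines π (algebraMap ℂ (Module.End ℂ E) a) (algebraMap ℂ (Module.End ℂ F) a) :=
  fun f => by simp [Module.algebraMap_end_apply]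

theorem lie (h : Intertwines π S S') (k : Intertwines π T T') :
    Intertwines π ⁅S, T⁆ ⁅S', T'⁆ := by
  simpa only [Ring.lie_def] using (h.mul k).sub (k.mul h)

theorem aeval (h : Intertwines π S S') (p : ℂ[X]) :
    Intertwines π (aeval S p) (aeval S' p) := by
  induction p using Polynomial.induction_on with
  | C a => simpa only [aeval_C] using scalar π a
  | add p q hp hq => simpa only [map_add] using hp.add hq
  | monomial n a ih =>
    simpa only [pow_succ, ← mul_assoc, map_mul, aeval_X] using ih.mul h

theorem eq_of_surjective (hπ : Function.Surjective π) (h : Intertwines π S S')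
    (k : Intertwines π S T') : S' = T' := by
  ext1 g
  obtain ⟨f, rfl⟩ := hπ g
  rw [← h, ← k]

theorem eq_of_injective (hπ : Function.Injective π) (h : Intertwines π S S')
    (k : Intertwines π T S') : S = T := by
  ext1 f
  apply hπ
  rw [h, k]

end Intertwines

/-- The relation `[H, [H, X]] = W₁(H) X + W₂(H) [H, X] + W₀(H)`. -/
def DoubleCommutatorRelation {𝔄 : Type*} [Ring 𝔄] [Algebra ℂ 𝔄] (W₀ W₁ W₂ : ℂ[X]) (H K : 𝔄) :
    Prop :=
  ⁅H, ⁅H, K⁆⁆ = aeval H W₁ * K + aeval H W₂ * ⁅H, K⁆ + aeval H W₀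

/-- Used to restrict the relation from `D` to one lattice, and to reflect it. -/
theorem DoubleCommutatorRelation.of_surjective {E F : Type*} [AddCommGroup E] [Module ℂ E]
    [AddCommGroup F] [Module ℂ F] {π : E →ₗ[ℂ] F} (hπ : Function.Surjective π)
    {H K : Module.End ℂ E} {H' K' : Module.End ℂ F} (hH : Intertwines π H H')
    (hK : Intertwines π K K') {W₀ W₁ W₂ : ℂ[X]} (h : DoubleCommutatorRelation W₀ W₁ W₂ H K) :
    DoubleCommutatorRelation W₀ W₁ W₂ H' K' := by
  have h₁ := hH.lie (hH.lie hK)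
  rw [h] at h₁
  exact Intertwines.eq_of_surjective hπ h₁
    ((((hH.aeval W₁).mul hK).add ((hH.aeval W₂).mul (hH.lie hK))).add (hH.aeval W₀))

/-- The opposite direction: from sequences back to functions on `s₀ + ℤ`. -/
theorem IsAW3.of_injective {E F : Type*} [AddCommGroup E] [Module ℂ E]
    [AddCommGroup F] [Module ℂ F] {π : E →ₗ[ℂ] F} (hπ : Function.Injective π)
    {H K L : Module.End ℂ E} {H' K' L' : Module.End ℂ F} (hH : Intertwines π H H')
    (hK : Intertwines π K K') (hL : Intertwines π L L') {ρ a₁ a₂ c₁ c₂ d g₁ g₂ : ℂ}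
    (h : IsAW3 ρ a₁ a₂ c₁ c₂ d g₁ g₂ H' K' L') : IsAW3 ρ a₁ a₂ c₁ c₂ d g₁ g₂ H K L where
  comm₁₂ := by
    have h₁ := hH.lie hK
    rw [h.comm₁₂] at h₁
    exact h₁.eq_of_injective hπ hL
  comm₂₃ := by
    have h₁ := hK.lie hL
    rw [h.comm₂₃] at h₁
    refine h₁.eq_of_injective hπ ?_
    rw [pow_two, pow_two]
    exact (((((((hK.mul hH).mul hK).smul _).add (((hH.mul hK).add (hK.mul hH)).smul _)).add
      ((hK.mul hK).smul _)).add (hH.smul _)).add (hK.smul _)).add (.scalar π _)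
  comm₃₁ := by
    have h₁ := hL.lie hH
    rw [h.comm₃₁] at h₁
    refine h₁.eq_of_injective hπ ?_
    rw [pow_two, pow_two]
    exact (((((((hH.mul hK).mul hH).smul _).add (((hH.mul hK).add (hK.mul hH)).smul _)).add
      ((hH.mul hH).smul _)).add (hK.smul _)).add (hH.smul _)).add (.scalar π _)

/-! ### Difference operators on sequences -/

/-- Multiplication of two-sided sequences by the sequence `g`. -/
def seqMul (g : ℤ → ℂ) : Module.End ℂ (ℤ → ℂ) where
  toFun f := fun n => g n * f n
  map_add' f₁ f₂ := by funext n; simp [mul_add]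
  map_smul' c f := by funext n; simp [mul_left_comm]

/-- The three-term difference operator `f ↦ (n ↦ A n f (n+1) + C n f (n-1) + B n f n)`. -/
def seqDiffOp (A B C : ℤ → ℂ) : Module.End ℂ (ℤ → ℂ) where
  toFun f := fun n => A n * f (n + 1) + C n * f (n - 1) + B n * f n
  map_add' f₁ f₂ := by funext n; simp; ring
  map_smul' c f := by funext n; simp; ring

@[simp]
theorem seqMul_apply (g f : ℤ → ℂ) (n : ℤ) : seqMul g f n = g n * f n := rfl

theorem seqDiffOp_apply (A B C f : ℤ → ℂ) (n : ℤ) :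
    seqDiffOp A B C f n = A n * f (n + 1) + C n * f (n - 1) + B n * f n := rfl

/-- Reflection of two-sided sequences. -/
def seqReflect : (ℤ → ℂ) →ₗ[ℂ] (ℤ → ℂ) where
  toFun f := fun n => f (-n)
  map_add' _ _ := rfl
  map_smul' _ _ := rfl

theorem seqReflect_surjective : Function.Surjective seqReflect :=
  fun f => ⟨fun n => f (-n), by funext n; simp [seqReflect]⟩

theorem intertwines_seqReflect_seqMul (g : ℤ → ℂ) :
    Intertwines seqReflect (seqMul g) (seqMul fun n => g (-n)) := fun _ => rfl

theorem intertwines_seqReflect_seqDiffOp (A B C : ℤ → ℂ) :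
    Intertwines seqReflect (seqDiffOp A B C)
      (seqDiffOp (fun n => C (-n)) (fun n => B (-n)) (fun n => A (-n))) := by
  intro f
  funext n
  simp only [seqReflect, LinearMap.coe_mk, AddHom.coe_mk, seqDiffOp_apply]
  rw [show -(n + 1) = -n - 1 by ring, show -(n - 1) = -n + 1 by ring]
  ring

/-! ### Restriction to a lattice -/

namespace ShiftDomain

/-- Restriction of functions of `s` to the lattice `s₀ + ℤ`, as two-sided sequences. -/
def toSeq (D : ShiftDomain) (s₀ : ℂ) (h : ∀ n : ℤ, s₀ + n ∈ D.carrier) :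
    D.Fun →ₗ[ℂ] (ℤ → ℂ) where
  toFun f := fun n => f ⟨s₀ + n, h n⟩
  map_add' _ _ := rfl
  map_smul' _ _ := rfl

theorem add_int_mem (D : ShiftDomain) {s₀ : ℂ} (h : s₀ ∈ D.carrier) (n : ℤ) :
    s₀ + n ∈ D.carrier := by
  induction n using Int.induction_on with
  | zero => simpa using h
  | succ n ih =>
    have := D.add_one_mem _ ih
    rwa [add_assoc, ← Int.cast_one, ← Int.cast_add] at this
  | pred n ih =>
    have := D.sub_one_mem _ ih
    rwa [add_sub_assoc, ← Int.cast_one, ← Int.cast_sub] at this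

theorem add_int_injective (s₀ : ℂ) : Function.Injective fun n : ℤ => s₀ + (n : ℂ) :=
  fun m n h => by simpa using h

theorem toSeq_surjective (D : ShiftDomain) (s₀ : ℂ) (h : ∀ n : ℤ, s₀ + n ∈ D.carrier) :
    Function.Surjective (D.toSeq s₀ h) := fun f =>
  ⟨fun s => Function.extend (fun n : ℤ => s₀ + (n : ℂ)) f 0 s, by
    funext n
    exact (add_int_injective s₀).extend_apply f 0 n⟩

theorem toSeq_lattice_injective (s₀ : ℂ) (h : ∀ n : ℤ, s₀ + n ∈ (lattice s₀).carrier) :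
    Function.Injective ((lattice s₀).toSeq s₀ h) := by
  intro f g hfg
  funext ⟨s, n, hs⟩
  subst hs
  exact congrFun hfg n

theorem intertwines_toSeq_mulOp (D : ShiftDomain) (s₀ : ℂ) (h : ∀ n : ℤ, s₀ + n ∈ D.carrier)
    (g : ℂ → ℂ) : Intertwines (D.toSeq s₀ h) (D.mulOp g) (seqMul fun n => g (s₀ + n)) :=
  fun _ => rfl

theorem diffOp_apply (D : ShiftDomain) (A B C : ℂ → ℂ) (f : D.Fun) (s : D.carrier) :
    D.diffOp A B C f s = A s * f ⟨(s : ℂ) + 1, D.add_one_mem s s.2⟩ +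
      C s * f ⟨(s : ℂ) - 1, D.sub_one_mem s s.2⟩ + B s * f s := rfl

theorem intertwines_toSeq_diffOp (D : ShiftDomain) (s₀ : ℂ) (h : ∀ n : ℤ, s₀ + n ∈ D.carrier)
    (A B C : ℂ → ℂ) : Intertwines (D.toSeq s₀ h) (D.diffOp A B C)
      (seqDiffOp (fun n => A (s₀ + n)) (fun n => B (s₀ + n)) fun n => C (s₀ + n)) := by
  intro f
  funext n
  simp only [toSeq, LinearMap.coe_mk, AddHom.coe_mk, diffOp_apply, seqDiffOp_apply, Int.cast_add,
    Int.cast_sub, Int.cast_one, add_assoc, add_sub_assoc]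

end ShiftDomain

/-! ### The degrees -/

/-- The sequence `f` vanishes below `m` and takes the value `v` at `m`. -/
def StartsAt (f : ℤ → ℂ) (m : ℤ) (v : ℂ) : Prop :=
  (∀ n < m, f n = 0) ∧ f m = v

namespace StartsAt

theorem single (m : ℤ) : StartsAt (Pi.single m 1) m 1 :=
  ⟨fun _ hn => Pi.single_eq_of_ne hn.ne 1, Pi.single_eq_same m 1⟩

theorem of_lt {f : ℤ → ℂ} {m k : ℤ} {v : ℂ} (h : StartsAt f m v) (hk : k < m) :
    StartsAt f k 0 := ⟨fun n hn => h.1 n (hn.trans hk), h.1 k hk⟩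

theorem add {f g : ℤ → ℂ} {m : ℤ} {v w : ℂ} (hf : StartsAt f m v) (hg : StartsAt g m w) :
    StartsAt (f + g) m (v + w) :=
  ⟨fun n hn => by simp [hf.1 n hn, hg.1 n hn], by simp [hf.2, hg.2]⟩

theorem sub {f g : ℤ → ℂ} {m : ℤ} {v w : ℂ} (hf : StartsAt f m v) (hg : StartsAt g m w) :
    StartsAt (f - g) m (v - w) :=
  ⟨fun n hn => by simp [hf.1 n hn, hg.1 n hn], by simp [hf.2, hg.2]⟩

theorem smul {f : ℤ → ℂ} {m : ℤ} {v : ℂ} (a : ℂ) (hf : StartsAt f m v) :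
    StartsAt (a • f) m (a * v) :=
  ⟨fun n hn => by simp [hf.1 n hn], by simp [hf.2]⟩

theorem seqMul {f : ℤ → ℂ} {m : ℤ} {v : ℂ} (g : ℤ → ℂ) (hf : StartsAt f m v) :
    StartsAt (seqMul g f) m (g m * v) :=
  ⟨fun n hn => by simp [hf.1 n hn], by simp [hf.2]⟩

theorem seqDiffOp {f : ℤ → ℂ} {m : ℤ} {v : ℂ} (A B C : ℤ → ℂ) (hf : StartsAt f m v) :
    StartsAt (seqDiffOp A B C f) (m - 1) (A (m - 1) * v) := by
  refine ⟨fun n hn => ?_, ?_⟩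
  · rw [seqDiffOp_apply, hf.1 (n + 1) (by lia), hf.1 (n - 1) (by lia), hf.1 n (by lia)]
    simp
  · rw [seqDiffOp_apply, hf.1 (m - 1 - 1) (by lia), hf.1 (m - 1) (by lia), sub_add_cancel, hf.2]
    simp

theorem seqDiffOp_pow {f : ℤ → ℂ} {m : ℤ} {v : ℂ} (A B C : ℤ → ℂ) (hf : StartsAt f m v) (k : ℕ) :
    StartsAt ((_root_.seqDiffOp A B C ^ k) f) (m - k)
      ((∏ i ∈ Finset.range k, A (m - i - 1)) * v) := by
  induction k with
  | zero => simpa using hf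
  | succ k ih =>
    rw [pow_succ', Module.End.mul_apply, Finset.prod_range_succ,
      mul_comm (∏ i ∈ Finset.range k, _), mul_assoc]
    have := ih.seqDiffOp A B C
    convert this using 1
    push_cast; ring

/-- Powers below `k` do not reach position `m - k`, so only the coefficient of degree `k` is seen
there. -/
theorem aeval_seqDiffOp {f : ℤ → ℂ} {m : ℤ} {v : ℂ} (A B C : ℤ → ℂ) (hf : StartsAt f m v)
    (p : ℂ[X]) (k : ℕ) (hp : p.natDegree ≤ k) :
    StartsAt (aeval (_root_.seqDiffOp A B C) p f) (m - k)
      (p.coeff k * ((∏ i ∈ Finset.range k, A (m - i - 1)) * v)) := by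
  have h : aeval (_root_.seqDiffOp A B C) p f =
      ∑ i ∈ Finset.range (k + 1), p.coeff i • (_root_.seqDiffOp A B C ^ i) f := by
    rw [aeval_eq_sum_range' (Nat.lt_succ_of_le hp), LinearMap.sum_apply]
    rfl
  rw [h, Finset.sum_range_succ, ← zero_add (p.coeff k * _)]
  refine add ?_ ((hf.seqDiffOp_pow A B C k).smul _)
  have hz : ∀ i ∈ Finset.range k, StartsAt (p.coeff i • (_root_.seqDiffOp A B C ^ i) f) (m - k) 0 :=
    fun i hi => ((hf.seqDiffOp_pow A B C i).smul _).of_lt (by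
      have := Finset.mem_range.1 hi
      lia)
  refine ⟨fun n hn => ?_, ?_⟩
  · rw [Finset.sum_apply]
    exact Finset.sum_eq_zero fun i hi => (hz i hi).1 n hn
  · rw [Finset.sum_apply]
    exact Finset.sum_eq_zero fun i hi => (hz i hi).2

theorem unique {f : ℤ → ℂ} {m : ℤ} {v w : ℂ} (h : StartsAt f m v) (k : StartsAt f m w) : v = w :=
  h.2.symm.trans k.2

end StartsAt

section Sequences

variable {A B C x : ℤ → ℂ} {W₀ W₁ W₂ : ℂ[X]}

theorem DoubleCommutatorRelation.reflect
    (h : DoubleCommutatorRelation W₀ W₁ W₂ (seqDiffOp A B C) (seqMul x)) :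
    DoubleCommutatorRelation W₀ W₁ W₂
      (seqDiffOp (fun n => C (-n)) (fun n => B (-n)) fun n => A (-n)) (seqMul fun n => x (-n)) :=
  h.of_surjective seqReflect_surjective (intertwines_seqReflect_seqDiffOp A B C)
    (intertwines_seqReflect_seqMul x)

/-- Both sides act on the delta sequence at `m` and are read at `m - (k + 3)`. The double commutator
reaches only `m - 2`; on the right every term carries the same nonzero product of values of `A`. -/
theorem DoubleCommutatorRelation.leading_coeff
    (h : DoubleCommutatorRelation W₀ W₁ W₂ (seqDiffOp A B C) (seqMul x)) (hA : ∀ n, A n ≠ 0)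
    (k : ℕ) (h₁ : W₁.natDegree ≤ k + 3) (h₂ : W₂.natDegree ≤ k + 2) (h₀ : W₀.natDegree ≤ k + 3)
    (m : ℤ) : W₁.coeff (k + 3) * x m + W₂.coeff (k + 2) * (x m - x (m - 1)) +
      W₀.coeff (k + 3) = 0 := by
  have hs := StartsAt.single m
  have hHX : StartsAt (⁅seqDiffOp A B C, seqMul x⁆ (Pi.single m 1)) (m - 1)
      (A (m - 1) * (x m * 1) - x (m - 1) * (A (m - 1) * 1)) := by
    rw [Ring.lie_def, LinearMap.sub_apply, Module.End.mul_apply, Module.End.mul_apply]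
    exact ((hs.seqMul x).seqDiffOp A B C).sub ((hs.seqDiffOp A B C).seqMul x)
  have hHHX : StartsAt (⁅seqDiffOp A B C, ⁅seqDiffOp A B C, seqMul x⁆⁆ (Pi.single m 1))
      (m - (k + 3 : ℕ)) 0 := by
    rw [Ring.lie_def, LinearMap.sub_apply, Module.End.mul_apply, Module.End.mul_apply]
    have hHX' := ((hs.seqDiffOp A B C).seqMul x).seqDiffOp A B C |>.sub
      (((hs.seqDiffOp A B C).seqDiffOp A B C).seqMul x)
    exact ((hHX.seqDiffOp A B C).sub hHX').of_lt (by lia)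
  rw [h, LinearMap.add_apply, LinearMap.add_apply, Module.End.mul_apply,
    Module.End.mul_apply] at hHHX
  have e₁ := (hs.seqMul x).aeval_seqDiffOp A B C W₁ (k + 3) h₁
  have e₂ := hHX.aeval_seqDiffOp A B C W₂ (k + 2) h₂
  have e₀ := hs.aeval_seqDiffOp A B C W₀ (k + 3) h₀
  rw [show m - 1 - ((k + 2 : ℕ) : ℤ) = m - (k + 3 : ℕ) by push_cast; ring] at e₂
  have key := hHHX.unique ((e₁.add e₂).add e₀)
  have hprod : ∏ i ∈ Finset.range (k + 3), A (m - i - 1) =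
      A (m - 1) * ∏ i ∈ Finset.range (k + 2), A (m - 1 - i - 1) := by
    rw [Finset.prod_range_succ', mul_comm]
    congr 1
    · simp
    · refine Finset.prod_congr rfl fun i _ => ?_
      congr 1
      push_cast; ring
  have hne : ∏ i ∈ Finset.range (k + 3), A (m - i - 1) ≠ 0 :=
    Finset.prod_ne_zero_iff.2 fun _ _ => hA _
  refine (mul_eq_zero.1 (?_ : (∏ i ∈ Finset.range (k + 3), A (m - i - 1)) * _ = 0)).resolve_left hne
  rw [hprod] at key ⊢
  linear_combination -key

theorem DoubleCommutatorRelation.natDegree_le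
    (h : DoubleCommutatorRelation W₀ W₁ W₂ (seqDiffOp A B C) (seqMul x)) (hA : ∀ n, A n ≠ 0)
    (hC : ∀ n, C n ≠ 0) (hx₁ : ∀ n, x n ≠ x (n + 1)) (hx₂ : ∀ n, x n ≠ x (n + 2)) :
    W₂.natDegree ≤ 1 ∧ W₁.natDegree ≤ 2 ∧ W₀.natDegree ≤ 2 := by
  have step : ∀ k : ℕ, W₂.natDegree ≤ k + 1 ∧ W₁.natDegree ≤ k + 2 ∧ W₀.natDegree ≤ k + 2 →
      W₂.natDegree ≤ 1 ∧ W₁.natDegree ≤ 2 ∧ W₀.natDegree ≤ 2 := by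
    intro k
    induction k with
    | zero => exact id
    | succ k ih =>
      rintro ⟨h₂, h₁, h₀⟩
      have e := h.leading_coeff hA k h₁ h₂ h₀
      have e' := h.reflect.leading_coeff (fun n => hC (-n)) k h₁ h₂ h₀
      -- The identity and its mirror image differ only in `x 1 - x 0` against `x 1 - x 2`, so
      -- subtraction isolates this coefficient.
      have z₂ : W₂.coeff (k + 2) = 0 := by
        have i₁ := e 1
        have i₂ := e' (-1)
        norm_num at i₁ i₂
        refine (mul_eq_zero.1 (?_ : _ * (x 0 - x 2) = 0)).resolve_right (sub_ne_zero.2 (hx₂ 0))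
        linear_combination i₂ - i₁
      have z₁ : W₁.coeff (k + 3) = 0 := by
        have i₁ := e 0
        have i₂ := e 1
        rw [z₂] at i₁ i₂
        refine (mul_eq_zero.1 (?_ : _ * (x 0 - x (0 + 1)) = 0)).resolve_right
          (sub_ne_zero.2 (hx₁ 0))
        rw [zero_add]
        linear_combination i₁ - i₂
      have z₀ : W₀.coeff (k + 3) = 0 := by
        have i₁ := e 0
        rw [z₂, z₁] at i₁
        linear_combination i₁
      exact ih ⟨natDegree_le_pred h₂ z₂, natDegree_le_pred h₁ z₁, natDegree_le_pred h₀ z₀⟩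
  exact step (W₂.natDegree + W₁.natDegree + W₀.natDegree) ⟨by lia, by lia, by lia⟩

end Sequences

/-! ### Recurrences on two-sided sequences -/

theorem eq_apply_zero_of_step {f : ℤ → ℂ} (h : ∀ n, f (n + 1) = f n) (n : ℤ) : f n = f 0 := by
  induction n using Int.induction_on with
  | zero => rfl
  | succ n ih => rw [h, ih]
  | pred n ih => rw [← ih, ← h, sub_add_cancel]

theorem eq_of_recurrence {x y : ℤ → ℂ} {η ζ : ℂ}
    (hx : ∀ n, x (n + 1) + x (n - 1) + η * x n + ζ = 0)
    (hy : ∀ n, y (n + 1) + y (n - 1) + η * y n + ζ = 0) (h₀ : x 0 = y 0) (h₁ : x 1 = y 1)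
    (n : ℤ) : x n = y n := by
  suffices h : x n = y n ∧ x (n + 1) = y (n + 1) from h.1
  induction n using Int.induction_on with
  | zero => exact ⟨h₀, by simpa using h₁⟩
  | succ n ih =>
    refine ⟨ih.2, ?_⟩
    have h₂ := hx (n + 1)
    have h₃ := hy (n + 1)
    rw [add_sub_cancel_right] at h₂ h₃
    linear_combination h₂ - h₃ - ih.1 - η * ih.2
  | pred n ih =>
    rw [sub_add_cancel]
    refine ⟨?_, ih.1⟩
    linear_combination hx (-n) - hy (-n) - ih.2 - η * ih.1

theorem exists_ne_zero_of_ratio {g : ℤ → ℂ} (hg : ∀ n, g n ≠ 0) :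
    ∃ F : ℤ → ℂ, (∀ n, F n ≠ 0) ∧ ∀ n, F (n + 1) = F n * g n := by
  refine ⟨fun n => match n with
    | Int.ofNat k => ∏ i ∈ Finset.range k, g i
    | Int.negSucc k => ∏ i ∈ Finset.range (k + 1), (g (-(i + 1)))⁻¹, ?_, ?_⟩
  · rintro (k | k)
    · exact Finset.prod_ne_zero_iff.2 fun i _ => hg i
    · exact Finset.prod_ne_zero_iff.2 fun i _ => inv_ne_zero (hg _)
  · rintro (k | k)
    · exact Finset.prod_range_succ _ _
    · rcases k with _ | k
      · have := hg (-1)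
        simp [Int.negSucc_eq, this]
      · have h : Int.negSucc (k + 1) + 1 = Int.negSucc k := by simp [Int.negSucc_eq]
        have h₂ : (-((k + 1 : ℕ) + 1 : ℤ)) = Int.negSucc (k + 1) := by simp [Int.negSucc_eq]
        rw [h]
        simp only
        rw [Finset.prod_range_succ _ (k + 1), h₂, mul_assoc, inv_mul_cancel₀ (hg _), mul_one]

/-- The two-sided sequences that satisfy `x (n+1) + x (n-1) + η x n + ζ = 0`. -/
theorem askeyWilson_grid_cases {x : ℤ → ℂ} {η ζ : ℂ}
    (hx : ∀ n, x (n + 1) + x (n - 1) + η * x n + ζ = 0) :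
    ∃ c₀ c₁ c₂ : ℂ,
      (∃ q : ℂ, q ≠ 0 ∧ q ≠ 1 ∧ q ≠ -1 ∧ ∀ n : ℤ, x n = c₁ * q ^ n + c₂ * q ^ (-n) + c₀) ∨
      (∀ n : ℤ, x n = c₂ * (n : ℂ) ^ 2 + c₁ * n + c₀) ∨
      (∀ n : ℤ, x n = (-1) ^ n * (c₁ + c₂ * (n : ℂ)) + c₀) := by
  by_cases h₁ : η = -2
  · subst h₁
    refine ⟨x 0, x 1 - x 0 + ζ / 2, -ζ / 2, Or.inr (Or.inl (eq_of_recurrence hx ?_ ?_ ?_))⟩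
    · intro n; push_cast; ring
    · simp
    · push_cast; ring
  by_cases h₂ : η = 2
  · subst h₂
    refine ⟨-ζ / 4, x 0 + ζ / 4, -(x 1 + ζ / 4) - (x 0 + ζ / 4),
      Or.inr (Or.inr (eq_of_recurrence hx ?_ ?_ ?_))⟩
    · intro n
      rw [zpow_add₀ (by norm_num), zpow_sub₀ (by norm_num)]
      push_cast; ring
    · simp; ring
    · push_cast; ring
  -- `w` is a square root of the discriminant of `q ^ 2 + η * q + 1`; its roots are `q` and `q⁻¹`.
  · obtain ⟨w, hw⟩ := IsAlgClosed.exists_pow_nat_eq (η ^ 2 - 4) (n := 2) (by norm_num)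
    have hq : ((w - η) / 2) ^ 2 + η * ((w - η) / 2) + 1 = 0 := by linear_combination hw / 4
    generalize (w - η) / 2 = q at hq
    have hη : 2 + η ≠ 0 := fun h => h₁ (by linear_combination h)
    have q0 : q ≠ 0 := by rintro rfl; simp at hq
    have q1 : q ≠ 1 := by rintro rfl; exact h₁ (by linear_combination hq)
    have q2 : q ≠ -1 := by rintro rfl; exact h₂ (by linear_combination -hq)
    have hqq : q ^ 2 - 1 ≠ 0 := by
      rw [show q ^ 2 - 1 = (q - 1) * (q + 1) by ring]
      exact mul_ne_zero (sub_ne_zero.2 q1) fun h => q2 (by linear_combination h)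
    -- `c₀` is the constant solution; `c₁` and `c₂` are fitted to `x 0` and `x 1`.
    refine ⟨-ζ / (2 + η), ((x 1 + ζ / (2 + η)) * q - (x 0 + ζ / (2 + η))) / (q ^ 2 - 1),
      (x 0 + ζ / (2 + η)) - ((x 1 + ζ / (2 + η)) * q - (x 0 + ζ / (2 + η))) / (q ^ 2 - 1),
      Or.inl ⟨q, q0, q1, q2, eq_of_recurrence hx ?_ ?_ ?_⟩⟩
    · intro n
      generalize ((x 1 + ζ / (2 + η)) * q - (x 0 + ζ / (2 + η))) / (q ^ 2 - 1) = c₁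
      generalize (x 0 + ζ / (2 + η)) - c₁ = c₂
      have hc : 2 * (-ζ / (2 + η)) + η * (-ζ / (2 + η)) + ζ = 0 := by field_simp; ring
      generalize -ζ / (2 + η) = c₀ at hc
      have e : q + q⁻¹ + η = 0 := by field_simp; linear_combination hq
      rw [zpow_add₀ q0, zpow_sub₀ q0, show -(n + 1) = -n - 1 by ring,
        show -(n - 1) = -n + 1 by ring, zpow_add₀ q0, zpow_sub₀ q0, zpow_one]
      simp only [div_eq_mul_inv]
      linear_combination (c₁ * q ^ n + c₂ * q ^ (-n)) * e + hc
    · simp; ring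
    · simp only [zpow_one, zpow_neg]
      field_simp
      ring

/-! ### The root of a quartic -/

theorem quartic_root_or_const (a₄ a₃ a₂ a₁ a₀ : ℂ) :
    (∃ m : ℂ, a₄ * m ^ 4 + a₃ * m ^ 3 + a₂ * m ^ 2 + a₁ * m + a₀ = 0) ∨
      (a₄ = 0 ∧ a₃ = 0 ∧ a₂ = 0 ∧ a₁ = 0 ∧ a₀ ≠ 0) := by
  set P : ℂ[X] := C a₄ * X ^ 4 + C a₃ * X ^ 3 + C a₂ * X ^ 2 + C a₁ * X + C a₀ with hP
  -- The zero polynomial has degree `⊥`, so it falls under the case with a root.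
  by_cases h : P.degree = 0
  · right
    have hC := eq_C_of_degree_eq_zero h
    have h0 : P ≠ 0 := by rintro h'; rw [h'] at h; simp at h
    have hc : ∀ n, P.coeff (n + 1) = 0 := fun n => by rw [hC]; simp
    have h1 := hc 0
    have h2 := hc 1
    have h3 := hc 2
    have h4 := hc 3
    simp [hP, coeff_C] at h1 h2 h3 h4
    refine ⟨h4, h3, h2, h1, ?_⟩
    rintro rfl
    exact h0 (by simp [hP, h1, h2, h3, h4])
  · obtain ⟨m, hm⟩ := IsAlgClosed.exists_root P h
    left
    exact ⟨m, by simpa [hP, IsRoot] using hm⟩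

/-! ### Comparison of coefficients -/

/-- The equations for the sequences `x`, `B` and `u n = A (n-1) C n` that are equivalent to the
double commutator relation. -/
structure IsAWData (x B u : ℤ → ℂ) (η ζ b c d g : ℂ) : Prop where
  ne_one : ∀ n, x n ≠ x (n + 1)
  ne_two : ∀ n, x n ≠ x (n + 2)
  u_ne : ∀ n, u n ≠ 0
  grid : ∀ n, x (n + 1) + x (n - 1) + η * x n + ζ = 0
  off : ∀ n, B n * (x n - x (n - 1)) + B (n + 1) * (x (n + 1) - x (n + 2)) +
    b * (x n + x (n + 1)) + d = 0
  diag : ∀ n, u (n + 1) * (x n - x (n + 2)) + u n * (x n - x (n - 2)) +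
    B n ^ 2 * (2 * x n - x (n + 1) - x (n - 1)) + 2 * b * x n * B n + c * x n + d * B n + g = 0

theorem coeff_eq_zero_of_forall {a₂ a₁ a₀ b₁ b₂ : ℂ} {n : ℤ}
    (h : ∀ f : ℤ → ℂ, a₂ * f (n + 2) + a₁ * f (n + 1) + a₀ * f n + b₁ * f (n - 1) +
      b₂ * f (n - 2) = 0) : a₂ = 0 ∧ a₁ = 0 ∧ a₀ = 0 ∧ b₁ = 0 ∧ b₂ = 0 := by
  refine ⟨?_, ?_, ?_, ?_, ?_⟩
  · simpa [Pi.single_apply, sub_eq_iff_eq_add, add_assoc] using h (Pi.single (n + 2) 1)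
  · simpa [Pi.single_apply, sub_eq_iff_eq_add, add_assoc] using h (Pi.single (n + 1) 1)
  · simpa [Pi.single_apply, sub_eq_iff_eq_add, add_assoc] using h (Pi.single n 1)
  · simpa [Pi.single_apply, sub_eq_add_neg, add_assoc] using h (Pi.single (n - 1) 1)
  · simpa [Pi.single_apply, sub_eq_add_neg, add_assoc] using h (Pi.single (n - 2) 1)

theorem exists_coeff_of_natDegree_le {W₀ W₁ W₂ : ℂ[X]}
    (h : W₂.natDegree ≤ 1 ∧ W₁.natDegree ≤ 2 ∧ W₀.natDegree ≤ 2) :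
    ∃ ρ b w₂ w₁ c a d g : ℂ, W₂ = Polynomial.C (2 * ρ) * X + Polynomial.C b ∧
      W₁ = Polynomial.C w₂ * X ^ 2 + Polynomial.C w₁ * X + Polynomial.C (-c) ∧
      W₀ = -(Polynomial.C a * X ^ 2 + Polynomial.C d * X + Polynomial.C g) := by
  obtain ⟨p, q, h₂⟩ := exists_eq_X_add_C_of_natDegree_le_one h.1
  have h₁ := eq_quadratic_of_degree_le_two (natDegree_le_iff_degree_le.1 h.2.1)
  have h₀ := eq_quadratic_of_degree_le_two (natDegree_le_iff_degree_le.1 h.2.2)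
  refine ⟨p / 2, q, W₁.coeff 2, W₁.coeff 1, -W₁.coeff 0, -W₀.coeff 2, -W₀.coeff 1, -W₀.coeff 0,
    ?_, ?_, ?_⟩
  · rw [mul_div_cancel₀ _ (two_ne_zero' ℂ)]; exact h₂
  · rw [neg_neg]; exact h₁
  · nth_rewrite 1 [h₀]
    simp only [map_neg]
    ring

theorem DoubleCommutatorRelation.coeff_eqs {A B C x : ℤ → ℂ} {ρ b w₂ w₁ c a d g : ℂ}
    (h : DoubleCommutatorRelation (-(Polynomial.C a * X ^ 2 + Polynomial.C d * X + Polynomial.C g))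
      (Polynomial.C w₂ * X ^ 2 + Polynomial.C w₁ * X + Polynomial.C (-c))
      (Polynomial.C (2 * ρ) * X + Polynomial.C b) (seqDiffOp A B C) (seqMul x)) (n : ℤ) :
    A n * A (n + 1) * (x (n + 2) - 2 * x (n + 1) + x n - w₂ * x (n + 2) -
      2 * ρ * (x (n + 2) - x (n + 1)) + a) = 0 ∧
    A n * (B n * x (n + 1) + B (n + 1) * x (n + 1) - 2 * (B n * x n + B (n + 1) * x (n + 1)) +
      x n * (B n + B (n + 1)) - w₂ * (B n + B (n + 1)) * x (n + 1) - w₁ * x (n + 1) -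
      2 * ρ * (B n * (x (n + 1) - x n)) - b * (x (n + 1) - x n) +
      a * (B n + B (n + 1)) + d) = 0 ∧
    2 * x n * (A n * C (n + 1) + A (n - 1) * C n + B n ^ 2) -
      (2 - 2 * ρ) * (A n * C (n + 1) * x (n + 1) + A (n - 1) * C n * x (n - 1) + B n ^ 2 * x n) -
      (w₂ + 2 * ρ) * x n * (A n * C (n + 1) + A (n - 1) * C n + B n ^ 2) -
      w₁ * B n * x n + c * x n + a * (A n * C (n + 1) + A (n - 1) * C n + B n ^ 2) + d * B n + g
        = 0 ∧
    C n * (B n * x (n - 1) + B (n - 1) * x (n - 1) - 2 * (B n * x n + B (n - 1) * x (n - 1)) +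
      x n * (B n + B (n - 1)) - w₂ * (B n + B (n - 1)) * x (n - 1) - w₁ * x (n - 1) -
      2 * ρ * (B n * (x (n - 1) - x n)) - b * (x (n - 1) - x n) +
      a * (B n + B (n - 1)) + d) = 0 ∧
    C n * C (n - 1) * (x (n - 2) - 2 * x (n - 1) + x n - w₂ * x (n - 2) -
      2 * ρ * (x (n - 2) - x (n - 1)) + a) = 0 := by
  apply coeff_eq_zero_of_forall (n := n)
  intro f
  have := congrFun (LinearMap.congr_fun h f) n
  simp only [Ring.lie_def, map_add, map_mul, map_neg, aeval_X, aeval_C, pow_two,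
    LinearMap.add_apply, LinearMap.sub_apply, LinearMap.neg_apply, Module.End.mul_apply,
    Module.algebraMap_end_apply, Pi.add_apply, Pi.sub_apply, Pi.neg_apply, Pi.smul_apply,
    smul_eq_mul, seqDiffOp_apply, seqMul_apply, add_sub_cancel_right, sub_add_cancel] at this
  rw [show n + 1 + 1 = n + 2 by ring, show n - 1 - 1 = n - 2 by ring] at this
  linear_combination this

theorem DoubleCommutatorRelation.isAWData {A B C x : ℤ → ℂ} {ρ b w₂ w₁ c a d g : ℂ}
    (h : DoubleCommutatorRelation (-(Polynomial.C a * X ^ 2 + Polynomial.C d * X + Polynomial.C g))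
      (Polynomial.C w₂ * X ^ 2 + Polynomial.C w₁ * X + Polynomial.C (-c))
      (Polynomial.C (2 * ρ) * X + Polynomial.C b) (seqDiffOp A B C) (seqMul x))
    (hA : ∀ n, A n ≠ 0) (hC : ∀ n, C n ≠ 0)
    (hx₁ : ∀ n, x n ≠ x (n + 1)) (hx₂ : ∀ n, x n ≠ x (n + 2)) :
    w₂ = -(2 * ρ) ∧ w₁ = -(2 * b) ∧
      IsAWData x B (fun n => A (n - 1) * C n) (2 * ρ - 2) a b c d g := by
  have e₂ : ∀ n, x (n + 2) - 2 * x (n + 1) + x n - w₂ * x (n + 2) -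
      2 * ρ * (x (n + 2) - x (n + 1)) + a = 0 := fun n =>
    (mul_eq_zero.1 (h.coeff_eqs n).1).resolve_left (mul_ne_zero (hA _) (hA _))
  have e₂' : ∀ n, x (n - 2) - 2 * x (n - 1) + x n - w₂ * x (n - 2) -
      2 * ρ * (x (n - 2) - x (n - 1)) + a = 0 := fun n =>
    (mul_eq_zero.1 (h.coeff_eqs n).2.2.2.2).resolve_left (mul_ne_zero (hC _) (hC _))
  obtain rfl : w₂ = -(2 * ρ) := by
    -- The coefficient of `T⁺²` at `n` and that of `T⁻²` at `n + 2` involve the same three grid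
    -- values.
    have key : ∀ n, (w₂ + 2 * ρ) * (x n - x (n + 2)) = 0 := fun n => by
      have i := e₂' (n + 2)
      rw [add_sub_cancel_right, show n + 2 - 1 = n + 1 by ring] at i
      linear_combination e₂ n - i
    linear_combination (mul_eq_zero.1 (key 0)).resolve_right (sub_ne_zero.2 (hx₂ 0))
  have grid : ∀ n, x (n + 1) + x (n - 1) + (2 * ρ - 2) * x n + a = 0 := fun n => by
    have := e₂ (n - 1)
    rw [show n - 1 + 2 = n + 1 by ring, sub_add_cancel] at this
    linear_combination this
  have e₁ := fun n => (mul_eq_zero.1 (h.coeff_eqs n).2.1).resolve_left (hA n)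
  have e₁' := fun n => (mul_eq_zero.1 (h.coeff_eqs n).2.2.2.1).resolve_left (hC n)
  obtain rfl : w₁ = -(2 * b) := by
    have i := e₁' (0 + 1)
    rw [add_sub_cancel_right] at i
    have : (w₁ + 2 * b) * (x 0 - x (0 + 1)) = 0 := by
      linear_combination e₁ 0 - i
    linear_combination (mul_eq_zero.1 this).resolve_right (sub_ne_zero.2 (hx₁ 0))
  refine ⟨rfl, rfl, hx₁, hx₂, fun n => mul_ne_zero (hA _) (hC _), grid, fun n => ?_, fun n => ?_⟩
  -- Subtracting multiples of the grid equation removes `ρ` and `a`, here and in the diagonal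
  -- equation.
  · have i := grid (n + 1)
    rw [add_sub_cancel_right, show n + 1 + 1 = n + 2 by ring] at i
    linear_combination e₁ n - B n * grid n - B (n + 1) * i
  · have i := grid (n + 1)
    have j := grid (n - 1)
    rw [add_sub_cancel_right, show n + 1 + 1 = n + 2 by ring] at i
    rw [sub_add_cancel, show n - 1 - 1 = n - 2 by ring] at j
    simp only [add_sub_cancel_right]
    linear_combination (h.coeff_eqs n).2.2.1 - A n * C (n + 1) * i - A (n - 1) * C n * j -
      B n ^ 2 * grid n

/-! ### First integrals -/

theorem exists_const_of_step {f : ℤ → ℂ} (h : ∀ n, f (n + 1) = f n) : ∃ k, ∀ n, f n = k :=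
  ⟨f 0, eq_apply_zero_of_step h⟩

/-- Here `y = x n`, and `D`, `E` are the steps after and before it. The factor `-(D + E)` turns the
diagonal equation, with `B` eliminated, into a difference of consecutive values of the integral. -/
theorem diag_step {b c d g k y y₂ y₃ u₀ u₁ D E : ℂ} (hD : D ≠ 0) (hE : E ≠ 0)
    (h : u₁ * (y - y₂) + u₀ * (y - y₃) + ((b * y ^ 2 + d * y + k) / (D * E)) ^ 2 * (E - D) +
      2 * b * y * ((b * y ^ 2 + d * y + k) / (D * E)) + c * y +
      d * ((b * y ^ 2 + d * y + k) / (D * E)) + g = 0) :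
    u₁ * (y + D - (y - E)) * (y₂ - y) -
        (b * y ^ 2 + d * y + k) * (b * (y + D) ^ 2 + d * (y + D) + k) / (y + D - y) ^ 2 -
        c * (y * (y + D)) - g * (y + (y + D)) =
      u₀ * (y - y₃) * (y + D - (y - E)) -
        (b * (y - E) ^ 2 + d * (y - E) + k) * (b * y ^ 2 + d * y + k) / (y - (y - E)) ^ 2 -
        c * ((y - E) * y) - g * (y - E + y) := by
  rw [add_sub_cancel_left, sub_sub_cancel, ← sub_eq_zero, ← neg_eq_zero,
    ← mul_zero (D + E), ← h]
  field_simp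
  ring

namespace IsAWData

variable {x B u : ℤ → ℂ} {η ζ b c d g : ℂ}

/-- Consecutive grid values lie on a fixed conic: the recurrence at `n + 1` times `x (n + 2) - x n`
telescopes. -/
theorem exists_grid_integral (h : IsAWData x B u η ζ b c d g) :
    ∃ k, ∀ n, x n ^ 2 + η * x n * x (n + 1) + x (n + 1) ^ 2 + ζ * (x n + x (n + 1)) + k = 0 := by
  obtain ⟨k, hk⟩ := exists_const_of_step (f := fun n =>
    -(x n ^ 2 + η * x n * x (n + 1) + x (n + 1) ^ 2 + ζ * (x n + x (n + 1)))) fun n => by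
      have := h.grid (n + 1)
      rw [add_sub_cancel_right] at this
      linear_combination -(x (n + 1 + 1) - x n) * this
  exact ⟨k, fun n => by linear_combination -hk n⟩

theorem exists_off_integral (h : IsAWData x B u η ζ b c d g) :
    ∃ k, ∀ n, B n * ((x (n + 1) - x n) * (x n - x (n - 1))) = b * x n ^ 2 + d * x n + k := by
  obtain ⟨k, hk⟩ := exists_const_of_step (f := fun n =>
    B n * ((x (n + 1) - x n) * (x n - x (n - 1))) - (b * x n ^ 2 + d * x n)) fun n => by
      have := h.off n
      rw [add_sub_cancel_right, show n + 1 + 1 = n + 2 by ring]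
      linear_combination -(x (n + 1) - x n) * this
  exact ⟨k, fun n => by linear_combination hk n⟩

theorem sub_ne (h : IsAWData x B u η ζ b c d g) (n : ℤ) : x (n + 1) - x n ≠ 0 :=
  sub_ne_zero.2 (h.ne_one n).symm

theorem sub_ne' (h : IsAWData x B u η ζ b c d g) (n : ℤ) : x n - x (n - 1) ≠ 0 := by
  simpa using h.sub_ne (n - 1)

theorem sub_two_ne (h : IsAWData x B u η ζ b c d g) (n : ℤ) : x (n + 1) - x (n - 1) ≠ 0 := by
  have := h.ne_two (n - 1)
  rw [show n - 1 + 2 = n + 1 by ring] at this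
  exact sub_ne_zero.2 this.symm

theorem B_eq (h : IsAWData x B u η ζ b c d g) {k : ℂ}
    (hk : ∀ n, B n * ((x (n + 1) - x n) * (x n - x (n - 1))) = b * x n ^ 2 + d * x n + k) (n : ℤ) :
    B n = (b * x n ^ 2 + d * x n + k) / ((x (n + 1) - x n) * (x n - x (n - 1))) :=
  (eq_div_iff (mul_ne_zero (h.sub_ne n) (h.sub_ne' n))).2 (hk n)

theorem exists_diag_integral (h : IsAWData x B u η ζ b c d g) {k : ℂ}
    (hk : ∀ n, B n * ((x (n + 1) - x n) * (x n - x (n - 1))) = b * x n ^ 2 + d * x n + k) :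
    ∃ ω, ∀ n, u n * (x n - x (n - 2)) * (x (n + 1) - x (n - 1)) * (x n - x (n - 1)) ^ 2 =
      (b * x (n - 1) ^ 2 + d * x (n - 1) + k) * (b * x n ^ 2 + d * x n + k) +
        (x n - x (n - 1)) ^ 2 * (c * (x (n - 1) * x n) + g * (x (n - 1) + x n) + ω) := by
  obtain ⟨ω, hω⟩ := exists_const_of_step (f := fun n =>
    u n * (x n - x (n - 2)) * (x (n + 1) - x (n - 1)) -
      (b * x (n - 1) ^ 2 + d * x (n - 1) + k) * (b * x n ^ 2 + d * x n + k) /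
        (x n - x (n - 1)) ^ 2 - c * (x (n - 1) * x n) - g * (x (n - 1) + x n)) fun n => by
      have i := h.diag n
      rw [h.B_eq hk] at i
      have h₁ := h.sub_ne n
      have h₂ := h.sub_ne' n
      rw [add_sub_cancel_right, show n + 1 + 1 = n + 2 by ring, show n + 1 - 2 = n - 1 by ring,
        show x (n + 1) = x n + (x (n + 1) - x n) by ring,
        show x (n - 1) = x n - (x n - x (n - 1)) by ring]
      exact diag_step h₁ h₂ (by linear_combination i)
  refine ⟨ω, fun n => ?_⟩
  have h₂ := h.sub_ne' n
  rw [← hω n]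
  field_simp
  ring

/-- Makes the denominator of `B n` a quadratic in `x n` alone. -/
theorem neg_prod_eq (h : IsAWData x B u η ζ b c d g) {k : ℂ}
    (hk : ∀ n, x n ^ 2 + η * x n * x (n + 1) + x (n + 1) ^ 2 + ζ * (x n + x (n + 1)) + k = 0)
    (n : ℤ) : (x (n + 1) - x n) * (x n - x (n - 1)) =
      -((2 + η) * x n ^ 2 + 2 * ζ * x n + k) := by
  linear_combination (x n - x (n + 1)) * h.grid n + hk n

end IsAWData

/-! ### The relations of `AW(3)` -/

theorem DoubleCommutatorRelation.lie_lie {𝔄 : Type*} [Ring 𝔄] [Algebra ℂ 𝔄] {ρ b c a d g : ℂ}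
    {H K : 𝔄} (h : DoubleCommutatorRelation
      (-(Polynomial.C a * X ^ 2 + Polynomial.C d * X + Polynomial.C g))
      (Polynomial.C (-(2 * ρ)) * X ^ 2 + Polynomial.C (-(2 * b)) * X + Polynomial.C (-c))
      (Polynomial.C (2 * ρ) * X + Polynomial.C b) H K) :
    ⁅⁅H, K⁆, H⁆ = (2 * ρ) • (H * K * H) + b • (H * K + K * H) + a • H ^ 2 + c • K + d • H +
      algebraMap ℂ 𝔄 g := by
  have e : ⁅⁅H, K⁆, H⁆ = -⁅H, ⁅H, K⁆⁆ := by
    simp only [Ring.lie_def]; noncomm_ring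
  rw [e, h]
  simp only [Ring.lie_def, map_add, map_mul, map_neg, map_pow, aeval_X, aeval_C]
  simp only [Algebra.algebraMap_eq_smul_one, smul_mul_assoc, mul_smul_comm, one_mul, add_mul,
    mul_sub, neg_mul, mul_assoc, pow_two]
  module

/-- In the relation for `[K₂, K₃]` the coefficients of `f (n ± 1)` are the grid conic; that of `f n`
is the integral for `B` combined with `neg_prod_eq`. -/
theorem DoubleCommutatorRelation.isAW3 {A B C x : ℤ → ℂ} {ρ b c a d g : ℂ}
    (h : DoubleCommutatorRelation (-(Polynomial.C a * X ^ 2 + Polynomial.C d * X + Polynomial.C g))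
      (Polynomial.C (-(2 * ρ)) * X ^ 2 + Polynomial.C (-(2 * b)) * X + Polynomial.C (-c))
      (Polynomial.C (2 * ρ) * X + Polynomial.C b) (seqDiffOp A B C) (seqMul x))
    (hd : IsAWData x B (fun n => A (n - 1) * C n) (2 * ρ - 2) a b c d g) :
    ∃ c₁ g₁ : ℂ, IsAW3 ρ a b c₁ c d g₁ g (seqDiffOp A B C) (seqMul x)
      ⁅seqDiffOp A B C, seqMul x⁆ := by
  obtain ⟨c₁, hc₁⟩ := hd.exists_grid_integral
  obtain ⟨g₁, hg₁⟩ := hd.exists_off_integral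
  refine ⟨c₁, g₁, rfl, ?_, ?_⟩
  · ext f n
    simp only [Ring.lie_def, pow_two,
      LinearMap.add_apply, LinearMap.sub_apply, Module.End.mul_apply, LinearMap.smul_apply,
      Module.algebraMap_end_apply, Pi.add_apply, Pi.sub_apply, Pi.smul_apply,
      smul_eq_mul, seqDiffOp_apply, seqMul_apply]
    have i := hc₁ (n - 1)
    rw [sub_add_cancel] at i
    linear_combination -A n * f (n + 1) * hc₁ n - C n * f (n - 1) * i + f n * hg₁ n -
      f n * B n * hd.neg_prod_eq hc₁ n
  · exact h.lie_lie

/-! ### Askey-Wilson operators on sequences -/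

/-- The coefficients `B n` and `u n = A (n-1) C n` of a three-term difference operator which is,
up to an additive constant and a similarity transformation, the Askey-Wilson operator on the
grid `x`. -/
def IsAWSeq (x B u : ℤ → ℂ) : Prop :=
  ∃ (σ τ : ℂ[X]) (r : ℂ) (a c : ℤ → ℂ), σ.natDegree ≤ 2 ∧ τ.natDegree ≤ 1 ∧
    (∀ n, a n = (σ.eval (x n) / (x (n + 1) - x (n - 1)) + τ.eval (x n)) / (x (n + 1) - x n)) ∧
    (∀ n, c n = (σ.eval (x n) / (x (n + 1) - x (n - 1)) - τ.eval (x n)) / (x n - x (n - 1))) ∧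
    (∀ n, B n = r - a n - c n) ∧ ∀ n, u n = a (n - 1) * c n

theorem IsAWSeq.translate {x B u : ℤ → ℂ} (v : ℂ) (h : IsAWSeq (fun n => x n - v) B u) :
    IsAWSeq x B u := by
  obtain ⟨σ, τ, r, a, c, hσ, hτ, ha, hc, hB, hu⟩ := h
  refine ⟨σ.comp (X - Polynomial.C v), τ.comp (X - Polynomial.C v), r, a, c, ?_, ?_, fun n => ?_,
    fun n => ?_, hB, hu⟩
  · rwa [natDegree_comp, natDegree_X_sub_C, mul_one]
  · rwa [natDegree_comp, natDegree_X_sub_C, mul_one]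
  · simpa using ha n
  · simpa using hc n

/-- With `y = x (n - 1)` and `z = x n` the factors on the right are the numerators of `a (n - 1)`
and `c n`. The two sides differ by a multiple of the conic. -/
theorem awFactor_mul_awFactor {η ζ b c d g k κ ω α β γ y z : ℂ}
    (hyz : y ^ 2 + η * y * z + z ^ 2 + ζ * (y + z) + k = 0)
    (h₁ : c = -α * b * (1 - η) - β * b - (α ^ 2 + β ^ 2 - η * α * β))
    (h₂ : g = α * b * ζ - α * d - γ * b + α * β * ζ - γ * (α + β))
    (h₃ : ω = α * b * k - α * κ + β * κ - γ * d + α * β * k - γ ^ 2) :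
    (b * y ^ 2 + d * y + κ) * (b * z ^ 2 + d * z + κ) +
        (z - y) ^ 2 * (c * (y * z) + g * (y + z) + ω) =
      (-(b * y ^ 2 + d * y + κ) + (z - y) * (α * z + β * y + γ)) *
        (-(b * z ^ 2 + d * z + κ) - (z - y) * (α * y + β * z + γ)) := by
  subst h₁ h₂ h₃
  linear_combination (z - y) ^ 2 * (α * (b + β)) * hyz

namespace IsAWData

variable {x B u : ℤ → ℂ} {η ζ b c d g : ℂ}

theorem isAWSeq (h : IsAWData x B u η ζ b c d g) {k κ ω α β γ : ℂ}
    (hk : ∀ n, x n ^ 2 + η * x n * x (n + 1) + x (n + 1) ^ 2 + ζ * (x n + x (n + 1)) + k = 0)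
    (hκ : ∀ n, B n * ((x (n + 1) - x n) * (x n - x (n - 1))) = b * x n ^ 2 + d * x n + κ)
    (hω : ∀ n, u n * (x n - x (n - 2)) * (x (n + 1) - x (n - 1)) * (x n - x (n - 1)) ^ 2 =
      (b * x (n - 1) ^ 2 + d * x (n - 1) + κ) * (b * x n ^ 2 + d * x n + κ) +
        (x n - x (n - 1)) ^ 2 * (c * (x (n - 1) * x n) + g * (x (n - 1) + x n) + ω))
    (h₁ : c = -α * b * (1 - η) - β * b - (α ^ 2 + β ^ 2 - η * α * β))
    (h₂ : g = α * b * ζ - α * d - γ * b + α * β * ζ - γ * (α + β))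
    (h₃ : ω = α * b * k - α * κ + β * κ - γ * d + α * β * k - γ ^ 2) : IsAWSeq x B u := by
  -- `t` and `s` come from matching `e₁` below: the recurrence eliminates `x (n - 2)`, the conic
  -- eliminates `x n ^ 2`, and powers of `x n` are compared. The additive constant is `α`.
  set t : ℂ → ℂ := fun y => ((β - α * (η + 1)) / 2) * y + (γ - α * ζ) / 2 with ht
  set s : ℂ → ℂ := fun y => -α * ((2 + η) * y ^ 2 + 2 * ζ * y + k) - (b * y ^ 2 + d * y + κ) -
    t y * ((2 + η) * y + ζ) with hs
  have hst : ∃ σ τ : ℂ[X], σ.natDegree ≤ 2 ∧ τ.natDegree ≤ 1 ∧ (∀ y, σ.eval y = s y) ∧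
      ∀ y, τ.eval y = t y := by
    refine ⟨Polynomial.C (-α * (2 + η) - b - (β - α * (η + 1)) / 2 * (2 + η)) * X ^ 2 +
      Polynomial.C (-α * (2 * ζ) - d - (β - α * (η + 1)) / 2 * ζ - (γ - α * ζ) / 2 * (2 + η)) * X +
      Polynomial.C (-α * k - κ - (γ - α * ζ) / 2 * ζ),
      Polynomial.C ((β - α * (η + 1)) / 2) * X + Polynomial.C ((γ - α * ζ) / 2),
      natDegree_quadratic_le, natDegree_linear_le, fun y => ?_, fun y => ?_⟩
    · simp only [eval_add, eval_mul, eval_C, eval_X, eval_pow, hs, ht]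
      ring
    · simp only [eval_add, eval_mul, eval_C, eval_X, ht]
  obtain ⟨σ, τ, hσ, hτ, eσ, eτ⟩ := hst
  refine ⟨σ, τ, α, _, _, hσ, hτ, fun _ => rfl, fun _ => rfl, fun n => ?_, fun n => ?_⟩
  · rw [h.B_eq hκ, eσ, eτ]
    have n₁ := h.sub_ne n
    have n₂ := h.sub_ne' n
    have n₃ := h.sub_two_ne n
    have e : b * x n ^ 2 + d * x n + κ = α * ((x (n + 1) - x n) * (x n - x (n - 1))) - s (x n) -
        t (x n) * (2 * x n - x (n + 1) - x (n - 1)) := by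
      simp only [hs]
      linear_combination -t (x n) * h.grid n - α * h.neg_prod_eq hk n
    rw [e]
    field_simp
    ring
  · rw [sub_add_cancel, show n - 1 - 1 = n - 2 by ring, eσ, eσ, eτ, eτ]
    have n₁ := h.sub_two_ne n
    have n₂ := h.sub_ne' n
    have n₃ := h.sub_two_ne (n - 1)
    have i := h.grid (n - 1)
    have j := hk (n - 1)
    rw [sub_add_cancel, show n - 1 - 1 = n - 2 by ring] at n₃ i
    rw [sub_add_cancel] at j
    have e₁ : s (x (n - 1)) + t (x (n - 1)) * (x n - x (n - 2)) =
        -(b * x (n - 1) ^ 2 + d * x (n - 1) + κ) +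
          (x n - x (n - 1)) * (α * x n + β * x (n - 1) + γ) := by
      simp only [hs, ht]
      linear_combination -((β - α * (η + 1)) / 2 * x (n - 1) + (γ - α * ζ) / 2) * i - α * j
    have e₂ : s (x n) - t (x n) * (x (n + 1) - x (n - 1)) =
        -(b * x n ^ 2 + d * x n + κ) -
          (x n - x (n - 1)) * (α * x (n - 1) + β * x n + γ) := by
      simp only [hs, ht]
      linear_combination -((β - α * (η + 1)) / 2 * x n + (γ - α * ζ) / 2) * h.grid n - α * j
    have key := hω n
    rw [awFactor_mul_awFactor j h₁ h₂ h₃, ← e₁, ← e₂] at key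
    have e₃ : (s (x (n - 1)) / (x n - x (n - 2)) + t (x (n - 1))) / (x n - x (n - 1)) *
        ((s (x n) / (x (n + 1) - x (n - 1)) - t (x n)) / (x n - x (n - 1))) =
        (s (x (n - 1)) + t (x (n - 1)) * (x n - x (n - 2))) *
          (s (x n) - t (x n) * (x (n + 1) - x (n - 1))) /
          ((x n - x (n - 2)) * (x (n + 1) - x (n - 1)) * (x n - x (n - 1)) ^ 2) := by
      field_simp
    rw [e₃, ← key]
    field_simp

end IsAWData

/-! ### Back to the lattice -/

namespace ShiftDomain

theorem isAskeyWilsonOp_of_isAWSeq {A B C x : ℂ → ℂ} {s₀ : ℂ}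
    (hA : ∀ n : ℤ, A (s₀ + n) ≠ 0) (hC : ∀ n : ℤ, C (s₀ + n) ≠ 0)
    (h : IsAWSeq (fun n => x (s₀ + n)) (fun n => B (s₀ + n))
      fun n => A (s₀ + (n - 1 : ℤ)) * C (s₀ + n)) :
    (lattice s₀).IsAskeyWilsonOp x ((lattice s₀).diffOp A B C) := by
  obtain ⟨σ, τ, r, a, c, hσ, hτ, ha, hc, hB, hu⟩ := h
  simp only at ha hc hB hu
  have ha₀ : ∀ n, a n ≠ 0 := fun n h0 => by
    have := hu (n + 1)
    rw [add_sub_cancel_right, h0, zero_mul] at this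
    exact mul_ne_zero (hA _) (hC _) this
  -- This ratio makes the `T⁺` coefficients agree; those of `T⁻` then agree because the products `u`
  -- do.
  obtain ⟨F, hF, hFs⟩ := exists_ne_zero_of_ratio (g := fun n => A (s₀ + n) / a n)
    fun n => div_ne_zero (hA n) (ha₀ n)
  set G : ℂ → ℂ := Function.extend (fun n : ℤ => s₀ + (n : ℂ)) F 1
  have hG : ∀ n : ℤ, G (s₀ + n) = F n := fun n => (add_int_injective s₀).extend_apply F 1 n
  refine ⟨σ, τ, r, G, hσ, hτ, ?_, ?_⟩
  · rintro s ⟨n, rfl⟩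
    rw [hG]
    exact hF n
  have hmem : ∀ n : ℤ, s₀ + n ∈ (lattice s₀).carrier := fun n => ⟨n, rfl⟩
  ext f ⟨s, n, hs⟩
  subst hs
  have hup : (s₀ + n + 1 : ℂ) = s₀ + (n + 1 : ℤ) := by push_cast; ring
  have hdn : (s₀ + n - 1 : ℂ) = s₀ + (n - 1 : ℤ) := by push_cast; ring
  have e₁ : G (s₀ + n) * ((lattice s₀).diffOp A B C
      ((lattice s₀).mulOp (fun s => (G s)⁻¹) f) ⟨s₀ + n, hmem n⟩) =
      a n * f ⟨s₀ + (n + 1 : ℤ), hmem _⟩ + c n * f ⟨s₀ + (n - 1 : ℤ), hmem _⟩ +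
        B (s₀ + n) * f ⟨s₀ + n, hmem n⟩ := by
    simp only [diffOp_apply, mulOp, LinearMap.coe_mk, AddHom.coe_mk, hup, hdn, hG]
    have h₁ := hFs n
    have h₂ := hFs (n - 1)
    rw [sub_add_cancel] at h₂
    have k₁ : F n * (A (s₀ + n) * (F (n + 1))⁻¹) = a n := by
      have := hF n
      have := ha₀ n
      have := hA n
      rw [h₁]
      field_simp
    have k₂ : F n * (C (s₀ + n) * (F (n - 1))⁻¹) = c n := by
      have := hF (n - 1)
      have := ha₀ (n - 1)
      have hu' := hu n
      rw [h₂]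
      field_simp
      linear_combination hu'
    have k₃ : F n * (F n)⁻¹ = 1 := mul_inv_cancel₀ (hF n)
    linear_combination f ⟨s₀ + (n + 1 : ℤ), hmem _⟩ * k₁ + f ⟨s₀ + (n - 1 : ℤ), hmem _⟩ * k₂ +
      B (s₀ + n) * f ⟨s₀ + n, hmem n⟩ * k₃
  have e₂ : ((lattice s₀).awOp x σ τ + algebraMap ℂ (lattice s₀).Op r) f ⟨s₀ + n, hmem n⟩ =
      a n * f ⟨s₀ + (n + 1 : ℤ), hmem _⟩ + c n * f ⟨s₀ + (n - 1 : ℤ), hmem _⟩ +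
        (r - a n - c n) * f ⟨s₀ + n, hmem n⟩ := by
    rw [ha, hc]
    simp only [awOp, forwardDiff, backwardDiff, mulOp, shiftUp, shiftDown, LinearMap.add_apply,
      LinearMap.sub_apply, Module.End.mul_apply, LinearMap.coe_mk, AddHom.coe_mk, Pi.add_apply,
      Pi.sub_apply, Module.algebraMap_end_apply, Pi.smul_apply, smul_eq_mul, hup, hdn,
      Module.End.one_apply]
    simp only [div_eq_mul_inv]
    ring
  rw [e₂, ← hB n]
  exact e₁

end ShiftDomain

/-! ### The equations for the parameters of the Askey-Wilson operator -/

/-- In the unknowns `m = α - β - b`, `ε = α + β + b`, `w = -α * (β + b)` and `γ + d / 2`, the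
equation for `c` is `h₁`, and those for `g` and `ω` prescribe `(γ + d / 2) * ε` and `(γ + d / 2) ^
2`. Compatibility of the last two is `h₂`. -/
theorem exists_aw_params {η ζ b c d g k κ ω m w : ℂ}
    (h₁ : m ^ 2 + (η - 2) * w + b * m + c = 0)
    (h₂ : (ζ * w + d / 2 * m + g) ^ 2 +
      (k * w + κ * m + (ω - d ^ 2 / 4 + b * κ)) * (m ^ 2 - 4 * w) = 0) :
    ∃ α β γ : ℂ, c = -α * b * (1 - η) - β * b - (α ^ 2 + β ^ 2 - η * α * β) ∧
      g = α * b * ζ - α * d - γ * b + α * β * ζ - γ * (α + β) ∧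
      ω = α * b * k - α * κ + β * κ - γ * d + α * β * k - γ ^ 2 := by
  obtain ⟨ε, hε⟩ := IsAlgClosed.exists_pow_nat_eq (m ^ 2 - 4 * w) (n := 2) (by norm_num)
  obtain ⟨γ, h₃, h₄⟩ : ∃ γ : ℂ, γ * ε = -(ζ * w + d / 2 * m + g) ∧
      γ ^ 2 = -(k * w + κ * m + (ω - d ^ 2 / 4 + b * κ)) := by
    by_cases h0 : ε = 0
    · obtain ⟨γ, hγ⟩ := IsAlgClosed.exists_pow_nat_eq
        (-(k * w + κ * m + (ω - d ^ 2 / 4 + b * κ))) (n := 2) (by norm_num)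
      rw [← hε, h0] at h₂
      have : ζ * w + d / 2 * m + g = 0 := pow_eq_zero_iff two_ne_zero |>.1 (by
        linear_combination h₂)
      exact ⟨γ, by rw [h0, this]; simp, hγ⟩
    · refine ⟨-(ζ * w + d / 2 * m + g) / ε, div_mul_cancel₀ _ h0, ?_⟩
      rw [div_pow, div_eq_iff (pow_ne_zero 2 h0), hε]
      linear_combination h₂
  obtain rfl : w = (m ^ 2 - ε ^ 2) / 4 := by linear_combination hε / 4
  refine ⟨(m + ε) / 2, -(m - ε) / 2 - b, γ - d / 2, ?_, ?_, ?_⟩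
  · linear_combination h₁
  · linear_combination h₃
  · linear_combination h₄

/-! ### The confluent operators -/

/-- The confluent coefficient sequences. -/
def IsConfluentSeq (x B u : ℤ → ℂ) : Prop :=
  ∃ g : ℤ → ℂ,
    ((∃ c₀ c₁ : ℂ, ∀ n : ℤ, x n = c₁ * n + c₀ ∧ g n = n) ∨
      (∃ c₀ c₁ q : ℂ, q ≠ 0 ∧ ∀ n : ℤ, x n = c₁ * q ^ n + c₀ ∧ g n = q ^ (-n))) ∧
    ∃ k l m : ℂ, l ≠ 0 ∧
      ((∀ n : ℤ, B n = k + l * g n ∧ u n = m) ∨ (∀ n : ℤ, B n = m ∧ u n = k + l * g n))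

theorem IsConfluentSeq.translate {x B u : ℤ → ℂ} (v : ℂ)
    (h : IsConfluentSeq (fun n => x n - v) B u) : IsConfluentSeq x B u := by
  obtain ⟨g, ⟨c₀, c₁, hg⟩ | ⟨c₀, c₁, q, hq, hg⟩, hk⟩ := h
  · exact ⟨g, Or.inl ⟨c₀ + v, c₁, fun n => ⟨by linear_combination (hg n).1, (hg n).2⟩⟩, hk⟩
  · exact ⟨g, Or.inr ⟨c₀ + v, c₁, q, hq, fun n => ⟨by linear_combination (hg n).1, (hg n).2⟩⟩, hk⟩

namespace IsAWData

variable {x B u : ℤ → ℂ} {η ζ b c d g : ℂ}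

theorem translate (h : IsAWData x B u η ζ b c d g) (v : ℂ) :
    IsAWData (fun n => x n - v) B u η (ζ + (2 + η) * v) b c (d + 2 * b * v) (g + c * v) where
  ne_one n := fun e => h.ne_one n (sub_left_injective e)
  ne_two n := fun e => h.ne_two n (sub_left_injective e)
  u_ne := h.u_ne
  grid n := by linear_combination h.grid n
  off n := by linear_combination h.off n
  diag n := by linear_combination h.diag n

/-- For `η = 2` the first parameter equation loses `w`: it determines `m`, and a quadratic in `w`
with leading coefficient `ζ ^ 2 - 4 * k` remains. -/
theorem isAWSeq_of_eta_eq_two (h : IsAWData x B u 2 ζ b c d g) : IsAWSeq x B u := by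
  obtain ⟨k, hk⟩ := h.exists_grid_integral
  obtain ⟨κ, hκ⟩ := h.exists_off_integral
  obtain ⟨ω, hω⟩ := h.exists_diag_integral hκ
  have hne : ζ ^ 2 - 4 * k ≠ 0 := fun h0 => by
    -- The conic would be a double line, and `x` would have period two.
    have hs : ∀ n, x n + x (n + 1) + ζ / 2 = 0 := fun n =>
      pow_eq_zero_iff two_ne_zero |>.1 (by linear_combination hk n + h0 / 4)
    have := hs (0 + 1)
    rw [show (0 : ℤ) + 1 + 1 = 0 + 2 by ring] at this
    exact h.ne_two 0 (by linear_combination hs 0 - this)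
  obtain ⟨t, ht⟩ := IsAlgClosed.exists_pow_nat_eq (b ^ 2 - 4 * c) (n := 2) (by norm_num)
  have hm : ((t - b) / 2) ^ 2 + b * ((t - b) / 2) + c = 0 := by linear_combination ht / 4
  generalize (t - b) / 2 = m at hm
  obtain ⟨w, hw⟩ | h0 := quartic_root_or_const 0 0 (ζ ^ 2 - 4 * k)
    (2 * ζ * (d / 2 * m + g) + k * m ^ 2 - 4 * (κ * m + (ω - d ^ 2 / 4 + b * κ)))
    ((d / 2 * m + g) ^ 2 + (κ * m + (ω - d ^ 2 / 4 + b * κ)) * m ^ 2)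
  · obtain ⟨α, β, γ, h₁, h₂, h₃⟩ := exists_aw_params (η := 2) (ζ := ζ) (b := b) (c := c) (d := d)
      (g := g) (k := k) (κ := κ) (ω := ω) (m := m) (w := w) (by linear_combination hm)
      (by linear_combination hw)
    exact h.isAWSeq hk hκ hω h₁ h₂ h₃
  · exact absurd h0.2.2.1 hne

theorem isAWSeq_or_of_eta_eq_neg_two (h : IsAWData x B u (-2) ζ b c d g) :
    IsAWSeq x B u ∨ IsConfluentSeq x B u := by
  obtain ⟨k, hk⟩ := h.exists_grid_integral
  obtain ⟨κ, hκ⟩ := h.exists_off_integral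
  obtain ⟨ω, hω⟩ := h.exists_diag_integral hκ
  obtain ⟨m, hm⟩ | ⟨a₄, a₃, a₂, a₁, a₀⟩ := quartic_root_or_const ((ζ / 4) ^ 2)
    (2 * (ζ / 4) * (ζ * b / 4 + d / 2) - b * k / 4)
    ((ζ * b / 4 + d / 2) ^ 2 + 2 * (ζ / 4) * (ζ * c / 4 + g) - c * k / 4 - b * (k * b / 4 + κ))
    (2 * (ζ * b / 4 + d / 2) * (ζ * c / 4 + g) - c * (k * b / 4 + κ) -
      b * (k * c / 4 + (ω - d ^ 2 / 4 + b * κ)))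
    ((ζ * c / 4 + g) ^ 2 - c * (k * c / 4 + (ω - d ^ 2 / 4 + b * κ)))
  · left
    obtain ⟨α, β, γ, h₁, h₂, h₃⟩ := exists_aw_params (η := -2) (ζ := ζ) (b := b) (c := c) (d := d)
      (g := g) (k := k) (κ := κ) (ω := ω) (m := m) (w := (m ^ 2 + b * m + c) / 4) (by ring)
      (by linear_combination hm)
    exact h.isAWSeq hk hκ hω h₁ h₂ h₃
  -- The quartic in `m` is a nonzero constant. Its leading coefficient makes the grid linear, the
  -- next gives `b = 0`, and the other two make `B` or `u` constant. When `d = 0`, the nonzero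
  -- constant term keeps `u` nonconstant.
  · right
    obtain rfl : ζ = 0 := by
      have := pow_eq_zero_iff two_ne_zero |>.1 a₄
      linear_combination 4 * this
    obtain ⟨D, hD⟩ := exists_const_of_step (f := fun n => x (n + 1) - x n) fun n => by
      have := h.grid (n + 1)
      rw [add_sub_cancel_right] at this
      linear_combination this
    have hD₀ : D ≠ 0 := hD 0 ▸ h.sub_ne 0
    obtain rfl : k = -D ^ 2 := by
      linear_combination hk 0 - (x (0 + 1) - x 0 + D) * hD 0
    obtain ⟨x₀, hx⟩ := exists_const_of_step (f := fun n => x n - D * n) fun n => by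
      push_cast
      linear_combination hD n
    obtain rfl : b = 0 := by
      refine (mul_eq_zero.1 (?_ : b * D ^ 2 = 0)).resolve_right (pow_ne_zero 2 hD₀)
      linear_combination 4 * a₃
    have hcd : d ^ 2 = -c * D ^ 2 := by linear_combination 4 * a₂
    have hdg : d * g = c * κ := by linear_combination a₁
    have hxn : ∀ n : ℤ, x n = D * n + x₀ := fun n => by linear_combination hx n
    have hB : ∀ n : ℤ, B n = (d * x₀ + κ) / D ^ 2 + d / D * n := fun n => by
      have := hκ n
      rw [hD n, show x n - x (n - 1) = D by simpa using hD (n - 1), hxn n] at this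
      field_simp
      linear_combination this
    have hu : ∀ n : ℤ, 4 * D ^ 4 * u n =
        (d * κ + D ^ 2 * g) * (2 * D * n + 2 * x₀ - D) + κ ^ 2 + D ^ 2 * ω := fun n => by
      have := hω n
      rw [hxn n, hxn (n + 1), hxn (n - 1), hxn (n - 2)] at this
      push_cast at this
      linear_combination this + (D * (n - 1) + x₀) * (D * n + x₀) * hcd
    refine ⟨fun n => n, Or.inl ⟨x₀, D, fun n => ⟨hxn n, rfl⟩⟩, ?_⟩
    by_cases hd : d = 0
    · subst hd
      have hc : c = 0 := by
        refine (mul_eq_zero.1 (?_ : c * D ^ 2 = 0)).resolve_right (pow_ne_zero 2 hD₀)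
        linear_combination hcd
      subst hc
      have hg : g ≠ 0 := by
        rintro rfl
        exact a₀ (by ring)
      refine ⟨(D ^ 2 * g * (2 * x₀ - D) + κ ^ 2 + D ^ 2 * ω) / (4 * D ^ 4), g / (2 * D), κ / D ^ 2,
        by simp [hg, hD₀], Or.inr fun n => ⟨by simpa using hB n, ?_⟩⟩
      have := hu n
      field_simp
      linear_combination 2 * this
    · refine ⟨_, _, (κ ^ 2 + D ^ 2 * ω) / (4 * D ^ 4), div_ne_zero hd hD₀,
        Or.inl fun n => ⟨hB n, ?_⟩⟩
      have hz : d * κ + D ^ 2 * g = 0 := by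
        refine (mul_eq_zero.1 (?_ : d * _ = 0)).resolve_left hd
        linear_combination κ * hcd + D ^ 2 * hdg
      have := hu n
      rw [hz] at this
      field_simp
      linear_combination this

/-- The conic is now a pair of lines through the origin, of slopes `q` and `q⁻¹`; the recurrence
keeps the ratio of neighbours constant. -/
theorem exists_ratio (h : IsAWData x B u η 0 b c d g)
    (hk : ∀ n, x n ^ 2 + η * x n * x (n + 1) + x (n + 1) ^ 2 = 0) :
    ∃ q : ℂ, q ≠ 0 ∧ q - 1 ≠ 0 ∧ q + 1 ≠ 0 ∧ q ^ 2 + η * q + 1 = 0 ∧ x 0 ≠ 0 ∧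
      ∀ n : ℤ, x n = x 0 * q ^ n := by
  have hx : ∀ n, x n ≠ 0 := fun n h0 => by
    have := h.neg_prod_eq (k := 0) (fun n => by linear_combination hk n) n
    rw [h0] at this
    exact mul_ne_zero (h.sub_ne n) (h.sub_ne' n) (by rw [h0, this]; ring)
  obtain ⟨q, hq⟩ := exists_const_of_step (f := fun n => x (n + 1) / x n) fun n => by
    have i := h.grid (n + 1)
    rw [add_sub_cancel_right] at i
    rw [div_eq_div_iff (hx _) (hx _)]
    linear_combination x n * i - hk n
  have hstep : ∀ n, x (n + 1) = x n * q := fun n => by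
    have := hq n
    rw [div_eq_iff (hx n)] at this
    rw [this, mul_comm]
  have q0 : q ≠ 0 := by
    rintro rfl
    exact hx (0 + 1) (by rw [hstep, mul_zero])
  have q1 : q - 1 ≠ 0 := fun e => h.ne_one 0 (by
    rw [hstep]
    linear_combination -x 0 * e)
  have q2 : q + 1 ≠ 0 := fun e => h.ne_two 0 (by
    rw [show (0 : ℤ) + 2 = 0 + 1 + 1 by ring, hstep, hstep]
    linear_combination -x 0 * (q - 1) * e)
  refine ⟨q, q0, q1, q2, ?_, hx 0, fun n => ?_⟩
  · have := hk 0
    rw [hstep] at this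
    refine (mul_eq_zero.1 (?_ : x 0 ^ 2 * _ = 0)).resolve_left (pow_ne_zero 2 (hx 0))
    linear_combination this
  · have := eq_apply_zero_of_step (f := fun n : ℤ => x n / q ^ n) (fun n => by
      rw [hstep, zpow_add_one₀ q0]
      field_simp) n
    simp only [zpow_zero, div_one] at this
    rw [← this, div_mul_cancel₀ _ (zpow_ne_zero n q0)]

theorem isAWSeq_or_of_zeta_eq_zero (h : IsAWData x B u η 0 b c d g) (hη : η ≠ 2)
    (hη' : 2 + η ≠ 0) : IsAWSeq x B u ∨ IsConfluentSeq x B u := by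
  obtain ⟨k, hk⟩ := h.exists_grid_integral
  obtain ⟨κ, hκ⟩ := h.exists_off_integral
  obtain ⟨ω, hω⟩ := h.exists_diag_integral hκ
  obtain ⟨s, hs⟩ : ∃ s, s * (2 - η) = 1 :=
    ⟨(2 - η)⁻¹, inv_mul_cancel₀ (sub_ne_zero.2 hη.symm)⟩
  have hs₀ : s ≠ 0 := by rintro rfl; simp at hs
  -- Indeed `1 - 4 * s = -(2 + η) * s`.
  have hs₁ : 1 - 4 * s ≠ 0 := fun h0 => hη' (by linear_combination -(2 - η) * h0 - 4 * hs)
  obtain ⟨m, hm⟩ | ⟨a₄, a₃, a₂, a₁, a₀⟩ := quartic_root_or_const (k * s * (1 - 4 * s))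
    ((k * s * b + κ) * (1 - 4 * s) - 4 * s * b * k * s)
    (d ^ 2 / 4 + (k * s * c + (ω - d ^ 2 / 4 + b * κ)) * (1 - 4 * s) -
      4 * s * b * (k * s * b + κ) - 4 * s * c * k * s)
    (d * g - 4 * s * b * (k * s * c + (ω - d ^ 2 / 4 + b * κ)) - 4 * s * c * (k * s * b + κ))
    (g ^ 2 - 4 * s * c * (k * s * c + (ω - d ^ 2 / 4 + b * κ)))
  · left
    obtain ⟨α, β, γ, h₁, h₂, h₃⟩ := exists_aw_params (η := η) (ζ := 0) (b := b) (c := c) (d := d)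
      (g := g) (k := k) (κ := κ) (ω := ω) (m := m) (w := s * (m ^ 2 + b * m + c))
      (by linear_combination -(m ^ 2 + b * m + c) * hs) (by linear_combination hm)
    exact h.isAWSeq hk hκ hω h₁ h₂ h₃
  · right
    obtain rfl : k = 0 := by simpa [hs₀, hs₁] using a₄
    obtain rfl : κ = 0 := by simpa [hs₁] using a₃
    obtain ⟨q, q0, q1, q2, hq, x0, hxn⟩ := h.exists_ratio fun n => by
      linear_combination hk n
    -- From `η = -(q + q⁻¹)` one has `2 - η = (q + 1) ^ 2 / q`.
    have hsq : s * (q + 1) ^ 2 = q := by linear_combination s * hq + q * hs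
    have hω' : (q - 1) ^ 2 * ω = -(q * d ^ 2) := by
      linear_combination (q + 1) ^ 2 * a₂ + (4 * ω - d ^ 2) * hsq
    have hdg : d * (q * b * d + (q - 1) ^ 2 * g) = 0 := by
      linear_combination (q - 1) ^ 2 * a₁ + 4 * s * b * hω' - b * d ^ 2 * hsq
    have hq₂ : q ^ 2 - 1 ≠ 0 := by
      rw [show q ^ 2 - 1 = (q - 1) * (q + 1) by ring]
      exact mul_ne_zero q1 q2
    have hB : ∀ n : ℤ, B n = b * q / (q - 1) ^ 2 + d * q / ((q - 1) ^ 2 * x 0) * q ^ (-n) :=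
      fun n => by
        have := hκ n
        rw [hxn n, hxn (n + 1), hxn (n - 1), zpow_add_one₀ q0, zpow_sub_one₀ q0] at this
        rw [zpow_neg]
        have hy := zpow_ne_zero n q0
        generalize q ^ n = y at *
        generalize x 0 = v at *
        have e : B n * ((q - 1) ^ 2 * (v * y)) = q * (b * (v * y) + d) := by
          refine mul_left_cancel₀ (mul_ne_zero x0 hy) ?_
          field_simp at this
          linear_combination this
        field_simp
        linear_combination e
    have hu : ∀ n : ℤ, u n =
        q ^ 2 * (q * b ^ 2 + (q - 1) ^ 2 * c) / ((q ^ 2 - 1) ^ 2 * (q - 1) ^ 2) +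
          (q + 1) * (q * b * d + (q - 1) ^ 2 * g) * q ^ 2 /
            ((q ^ 2 - 1) ^ 2 * (q - 1) ^ 2 * x 0) * q ^ (-n) := fun n => by
      have := hω n
      rw [show x (n - 2) = x (n - 1 - 1) by rw [show n - 1 - 1 = n - 2 by ring], hxn n,
        hxn (n + 1), hxn (n - 1), hxn (n - 1 - 1), zpow_add_one₀ q0, zpow_sub_one₀ q0,
        zpow_sub_one₀ q0] at this
      rw [zpow_neg]
      have hy := zpow_ne_zero n q0
      -- `v` is `x (n - 1)`.
      obtain ⟨v, hv⟩ : ∃ v, x 0 * q ^ n = q * v := ⟨x 0 * q ^ n / q, by field_simp⟩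
      have hv₀ : v ≠ 0 := by
        rintro rfl
        exact mul_ne_zero x0 hy (by rw [hv, mul_zero])
      have e : u n * (q ^ 2 - 1) ^ 2 * (q - 1) ^ 2 * v =
          q * (q * (q * b ^ 2 + (q - 1) ^ 2 * c) * v +
            (q + 1) * (q * b * d + (q - 1) ^ 2 * g)) := by
        refine mul_left_cancel₀ (pow_ne_zero 3 hv₀) ?_
        have hv₁ : x 0 * (q ^ n * q⁻¹) = v := by
          rw [← mul_assoc, hv]
          field_simp
        have hv₂ : x 0 * (q ^ n * q⁻¹ * q⁻¹) = v * q⁻¹ := by rw [← hv₁]; ring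
        have hv₃ : x 0 * (q ^ n * q) = q ^ 2 * v := by rw [← mul_assoc, hv]; ring
        rw [hv₂, hv₁, hv₃, hv] at this
        field_simp at this
        linear_combination this + v ^ 2 * q * hω'
      rw [show x 0 = q * v / q ^ n by rw [← hv]; field_simp]
      field_simp
      linear_combination e
    refine ⟨fun n => q ^ (-n), Or.inr ⟨0, x 0, q, q0, fun n => ⟨by simp [← hxn n], rfl⟩⟩, ?_⟩
    by_cases hd : d = 0
    · subst hd
      have hω₀ : ω = 0 := by simpa [q1] using hω'
      subst hω₀
      have hg : g ≠ 0 := by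
        rintro rfl
        exact a₀ (by ring)
      refine ⟨_, _, b * q / (q - 1) ^ 2, ?_, Or.inr fun n => ⟨by simpa using hB n, hu n⟩⟩
      simp [q0, q1, q2, x0, hg, hq₂]
    · refine ⟨_, _, q ^ 2 * (q * b ^ 2 + (q - 1) ^ 2 * c) / ((q ^ 2 - 1) ^ 2 * (q - 1) ^ 2),
        div_ne_zero (mul_ne_zero hd q0) (mul_ne_zero (pow_ne_zero 2 q1) x0),
        Or.inl fun n => ⟨hB n, ?_⟩⟩
      rw [hu n, (mul_eq_zero.1 hdg).resolve_left hd, mul_zero, zero_mul, zero_div, zero_mul,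
        add_zero]

theorem isAWSeq_or_isConfluentSeq (h : IsAWData x B u η ζ b c d g) :
    IsAWSeq x B u ∨ IsConfluentSeq x B u := by
  by_cases h₁ : η = 2
  · subst h₁
    exact Or.inl h.isAWSeq_of_eta_eq_two
  by_cases h₂ : 2 + η = 0
  · obtain rfl : η = -2 := by linear_combination h₂
    exact h.isAWSeq_or_of_eta_eq_neg_two
  -- Translating the grid by the constant solution of its recurrence reduces to `ζ = 0`.
  · have e : ζ + (2 + η) * (-ζ / (2 + η)) = 0 := by field_simp; ring
    have := h.translate (-ζ / (2 + η))
    rw [e] at this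
    exact (this.isAWSeq_or_of_zeta_eq_zero h₁ h₂).imp (IsAWSeq.translate _)
      (IsConfluentSeq.translate _)

end IsAWData

/-! ### The theorem on a general domain -/

theorem mainTheorem4 (D : ShiftDomain) (A B C x : ℂ → ℂ)
    (hAC : ∀ s ∈ D.carrier, A s * C s ≠ 0)
    (hx₁ : ∀ s ∈ D.carrier, x s ≠ x (s + 1))
    (hx₂ : ∀ s ∈ D.carrier, x s ≠ x (s + 2))
    (W₀ W₁ W₂ : ℂ[X])
    (hW : ⁅D.diffOp A B C, ⁅D.diffOp A B C, D.mulOp x⁆⁆ =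
      aeval (D.diffOp A B C) W₁ * D.mulOp x +
        aeval (D.diffOp A B C) W₂ * ⁅D.diffOp A B C, D.mulOp x⁆ +
        aeval (D.diffOp A B C) W₀) :
    -- the degrees
    (W₂.natDegree ≤ 1 ∧ W₁.natDegree ≤ 2 ∧ W₀.natDegree ≤ 2) ∧
    -- the grid
    (∃ η ζ : ℂ, ∀ s ∈ D.carrier, x (s + 1) + x (s - 1) + η * x s + ζ = 0) ∧
    (∀ s₀ ∈ D.carrier, IsExplicitAWGrid x s₀) ∧
    -- the operator
    (∀ s₀ ∈ D.carrier,
      (ShiftDomain.lattice s₀).IsAskeyWilsonOp x ((ShiftDomain.lattice s₀).diffOp A B C) ∨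
        IsConfluentOnLattice A B C x s₀) ∧
    -- the algebra
    (∃ ρ a₁ a₂ c₂ d g₂ : ℂ,
      W₂ = Polynomial.C (2 * ρ) * X + Polynomial.C a₂ ∧
      W₁ = -(Polynomial.C (2 * ρ) * X ^ 2 + Polynomial.C (2 * a₂) * X + Polynomial.C c₂) ∧
      W₀ = -(Polynomial.C a₁ * X ^ 2 + Polynomial.C d * X + Polynomial.C g₂) ∧
      ∀ s₀ ∈ D.carrier, ∃ c₁ g₁ : ℂ,
        IsAW3 ρ a₁ a₂ c₁ c₂ d g₁ g₂
          ((ShiftDomain.lattice s₀).diffOp A B C)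
          ((ShiftDomain.lattice s₀).mulOp x)
          ⁅(ShiftDomain.lattice s₀).diffOp A B C, (ShiftDomain.lattice s₀).mulOp x⁆) := by
  have hA : ∀ s ∈ D.carrier, A s ≠ 0 := fun s hs => left_ne_zero_of_mul (hAC s hs)
  have hC : ∀ s ∈ D.carrier, C s ≠ 0 := fun s hs => right_ne_zero_of_mul (hAC s hs)
  have hcast₁ : ∀ (s₀ : ℂ) (n : ℤ), s₀ + ((n + 1 : ℤ) : ℂ) = s₀ + n + 1 := fun s₀ n => by
    push_cast; ring
  have hcast₂ : ∀ (s₀ : ℂ) (n : ℤ), s₀ + ((n + 2 : ℤ) : ℂ) = s₀ + n + 2 := fun s₀ n => by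
    push_cast; ring
  have hcast₃ : ∀ (s₀ : ℂ) (n : ℤ), s₀ + ((n - 1 : ℤ) : ℂ) = s₀ + n - 1 := fun s₀ n => by
    push_cast; ring
  have hrel : ∀ s₀ ∈ D.carrier, DoubleCommutatorRelation W₀ W₁ W₂
      (seqDiffOp (fun n => A (s₀ + n)) (fun n => B (s₀ + n)) fun n => C (s₀ + n))
      (seqMul fun n => x (s₀ + n)) := fun s₀ hs₀ =>
    DoubleCommutatorRelation.of_surjective (D.toSeq_surjective s₀ (D.add_int_mem hs₀))
      (D.intertwines_toSeq_diffOp s₀ _ A B C) (D.intertwines_toSeq_mulOp s₀ _ x) hW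
  have hx₁' : ∀ s₀ ∈ D.carrier, ∀ n : ℤ, x (s₀ + n) ≠ x (s₀ + (n + 1 : ℤ)) := fun s₀ hs₀ n => by
    rw [hcast₁]
    exact hx₁ _ (D.add_int_mem hs₀ n)
  have hx₂' : ∀ s₀ ∈ D.carrier, ∀ n : ℤ, x (s₀ + n) ≠ x (s₀ + (n + 2 : ℤ)) := fun s₀ hs₀ n => by
    rw [hcast₂]
    exact hx₂ _ (D.add_int_mem hs₀ n)
  have hA' : ∀ s₀ ∈ D.carrier, ∀ n : ℤ, A (s₀ + n) ≠ 0 := fun s₀ hs₀ n =>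
    hA _ (D.add_int_mem hs₀ n)
  have hC' : ∀ s₀ ∈ D.carrier, ∀ n : ℤ, C (s₀ + n) ≠ 0 := fun s₀ hs₀ n =>
    hC _ (D.add_int_mem hs₀ n)
  obtain ⟨t₀, ht₀⟩ := D.nonempty
  have hdeg := (hrel t₀ ht₀).natDegree_le (hA' t₀ ht₀) (hC' t₀ ht₀) (hx₁' t₀ ht₀) (hx₂' t₀ ht₀)
  refine ⟨hdeg, ?_⟩
  obtain ⟨ρ, b, w₂, w₁, c, a, d, g, rfl, rfl, rfl⟩ := exists_coeff_of_natDegree_le hdeg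
  have hdata := fun s₀ hs₀ => (hrel s₀ hs₀).isAWData (hA' s₀ hs₀) (hC' s₀ hs₀) (hx₁' s₀ hs₀)
    (hx₂' s₀ hs₀)
  -- One lattice fixes the coefficients of the `Wᵢ`; hence `η = 2 * ρ - 2` and `ζ = a` serve all
  -- lattices.
  obtain ⟨rfl, rfl, -⟩ := hdata t₀ ht₀
  have haw := fun s₀ hs₀ => (hdata s₀ hs₀).2.2
  refine ⟨⟨2 * ρ - 2, a, fun s hs => by simpa [sub_eq_add_neg] using (haw s hs).grid 0⟩,
    fun s₀ hs₀ => askeyWilson_grid_cases (haw s₀ hs₀).grid, fun s₀ hs₀ => ?_,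
    ρ, a, b, c, d, g, rfl, ?_, rfl, fun s₀ hs₀ => ?_⟩
  · refine (haw s₀ hs₀).isAWSeq_or_isConfluentSeq.imp
      (ShiftDomain.isAskeyWilsonOp_of_isAWSeq (hA' s₀ hs₀) (hC' s₀ hs₀)) fun h => ?_
    simpa only [IsConfluentOnLattice, IsConfluentSeq, hcast₃] using h
  · simp only [map_neg, map_mul]
    ring
  · obtain ⟨c₁, g₁, h⟩ := (hrel s₀ hs₀).isAW3 (haw s₀ hs₀)
    have hmem : ∀ n : ℤ, s₀ + n ∈ (ShiftDomain.lattice s₀).carrier := fun n => ⟨n, rfl⟩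
    have hH := (ShiftDomain.lattice s₀).intertwines_toSeq_diffOp s₀ hmem A B C
    have hX := (ShiftDomain.lattice s₀).intertwines_toSeq_mulOp s₀ hmem x
    exact ⟨c₁, g₁, h.of_injective (ShiftDomain.toSeq_lattice_injective s₀ hmem) hH hX
      (hH.lie hX)⟩
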